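/- Let $N \ge 1$, $1 \le p < +\infty$, $\gamma < -p$, and let $u \in L^p(\mathbb{R}^N)$ be real-valued. Set $$\Phi(u) = \int_{\mathbb{R}^N} |\nabla u|^p \, dx \ \text{ if } p > 1, \qquad \Phi(u) = \sup\Big\{ \Big| \int_{\mathbb{R}^N} u \operatorname{div} \varphi \, dx \Big| : \varphi \in C_c^\infty(\mathbb{R}^N; \mathbb{R}^N),\ \|\varphi\|_{L^\infty} \le 1 \Big\} \ \text{ if } p = 1,$$ where $\nabla u$ is the weak gradient and $\Phi(u) = +\infty$ if $p > 1$ and $u \notin W^{1,p}(\mathbb{R}^N)$ (for $p=1$ the supremum is $+\infty$ exactly when $u \notin BV(\mathbb{R}^N)$). For $\lambda > 0$ set $$\Phi_\lambda(u) = \lambda^p \iint_{\left\{(x,y) \in \mathbb{R}^N \times \mathbb{R}^N \,:\, \frac{|u(x) - u(y)|}{|x-y|^{1 + \gamma/p}} > \lambda\right\}} |x-y|^{-N+\gamma} \, dx \, dy \in [0, +\infty],$$ and let $$K_{N,p} = \int_{\mathbb{S}^{N-1}} |e \cdot \sigma|^p \, d\sigma$$ for any unit vector $e \in \mathbb{S}^{N-1}$,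 where $d\sigma$ is the surface measure (the counting measure on $\{-1,1\}$ if $N = 1$). Then, in $[0,+\infty]$, $$\frac{K_{N,p}}{|\gamma|} \, \Phi(u) \le \limsup_{\lambda \to 0_+} \Phi_\lambda(u).$$ In particular, if $\limsup_{\lambda \to 0_+} \Phi_\lambda(u) < +\infty$, then $u \in W^{1,p}(\mathbb{R}^N)$ if $p > 1$ and $u \in BV(\mathbb{R}^N)$ if $p = 1$. -/

import Mathlib

open MeasureTheory Set Filter Topology
open scoped ENNReal ContDiff

namespace NonlocalBV

noncomputable section

/-- `N`-dimensional Euclidean space `ℝ^N`. -/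
abbrev Euc (N : ℕ) : Type := EuclideanSpace ℝ (Fin N)

/-- The partial derivative `∂f/∂x_i` (at points where `f` is differentiable). -/
def partialDeriv {N : ℕ} (i : Fin N) (f : Euc N → ℝ) (x : Euc N) : ℝ :=
  fderiv ℝ f x (EuclideanSpace.single i 1)

/-- The divergence `∑ i, ∂φ_i/∂x_i` of a vector field. -/
def divergence {N : ℕ} (φ : Euc N → Euc N) (x : Euc N) : ℝ :=
  ∑ i : Fin N, partialDeriv i (fun y => φ y i) x

/-- `g` is a weak (distributional) gradient of `u` on `ℝ^N`:
`∫ u ∂_i φ = - ∫ g_i φ` for all `φ ∈ C_c^∞(ℝ^N)` and all `i`. -/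
structure IsWeakGradient {N : ℕ} (u : Euc N → ℝ) (g : Euc N → Euc N) : Prop where
  locallyIntegrable : LocallyIntegrable u
  locallyIntegrable_grad : LocallyIntegrable g
  integral_eq : ∀ φ : Euc N → ℝ, ContDiff ℝ ∞ φ → HasCompactSupport φ → ∀ i : Fin N,
    ∫ x, u x * partialDeriv i φ x = - ∫ x, g x i * φ x

/-- The Sobolev space `W^{1,p}(ℝ^N)`. -/
def MemSobolev {N : ℕ} (p : ℝ) (u : Euc N → ℝ) : Prop :=
  MemLp u (ENNReal.ofReal p) ∧
    ∃ g : Euc N → Euc N, IsWeakGradient u g ∧ MemLp g (ENNReal.ofReal p)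

/-- The total variation `‖∇u‖_M` of `u`: the supremum of `|∫ u div φ|` over the smooth compactly
supported vector fields `φ` with `|φ| ≤ 1`. -/
def totalVariation {N : ℕ} (u : Euc N → ℝ) : ℝ≥0∞ :=
  ⨆ (φ : Euc N → Euc N) (_ : ContDiff ℝ ∞ φ) (_ : HasCompactSupport φ) (_ : ∀ x, ‖φ x‖ ≤ 1),
    ENNReal.ofReal |∫ x, u x * divergence φ x|

/-- The space `BV(ℝ^N)`. -/
def MemBV {N : ℕ} (u : Euc N → ℝ) : Prop :=
  MemLp u 1 ∧ totalVariation u < ⊤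

/-- `∫ |∇u|^p`, with value `∞` if `u` has no weak gradient in `L^p`. As weak gradients are unique
almost everywhere, the infimum is over at most one value. -/
def sobolevEnergy {N : ℕ} (p : ℝ) (u : Euc N → ℝ) : ℝ≥0∞ :=
  ⨅ (g : Euc N → Euc N) (_ : IsWeakGradient u g) (_ : MemLp g (ENNReal.ofReal p)),
    ∫⁻ x, ENNReal.ofReal (‖g x‖ ^ p)

/-- `Φ(u)`: the `p`-th power of the `L^p` norm of the gradient for `p > 1`, and the total variation
for `p = 1`; it is `∞` outside `W^{1,p}`, resp. `BV`. -/
def Phi {N : ℕ} (p : ℝ) (u : Euc N → ℝ) : ℝ≥0∞ :=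
  if p = 1 then totalVariation u else sobolevEnergy p u

/-- `Q_b u (x, y) = (u(x) - u(y)) / |x - y|^{1 + b}`. On the diagonal this is `0`. -/
def Q {N : ℕ} (b : ℝ) (u : Euc N → ℝ) (z : Euc N × Euc N) : ℝ :=
  (u z.1 - u z.2) / ‖z.1 - z.2‖ ^ (1 + b)

/-- `ν_γ(E) = ∬_E |x - y|^{-N + γ} dx dy`. -/
def nu {N : ℕ} (γ : ℝ) (E : Set (Euc N × Euc N)) : ℝ≥0∞ :=
  ∫⁻ z in E, ENNReal.ofReal (‖z.1 - z.2‖ ^ (-(N : ℝ) + γ))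

/-- `E_{t,b}(u) = {(x, y) : |Q_b u (x, y)| > t}`. -/
def superlevel {N : ℕ} (t b : ℝ) (u : Euc N → ℝ) : Set (Euc N × Euc N) :=
  {z | t < |Q b u z|}

/-- `Φ_t(u) = t^p ν_γ(E_{t,γ/p}(u))` for `t > 0`. -/
def PhiLevel {N : ℕ} (p γ t : ℝ) (u : Euc N → ℝ) : ℝ≥0∞ :=
  ENNReal.ofReal (t ^ p) * nu γ (superlevel t (γ / p) u)

/-- `K_{N,p} = ∫_{S^{N-1}} |e·σ|^p dσ`, for the surface measure `dσ` on the unit sphere (the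
counting measure on `{-1, 1}` if `N = 1`). It is the same for all unit vectors `e`. -/
def K {N : ℕ} (p : ℝ) (e : Euc N) : ℝ≥0∞ :=
  ∫⁻ σ : Metric.sphere (0 : Euc N) 1, ENNReal.ofReal (|inner ℝ e (σ : Euc N)| ^ p)
    ∂((volume : Measure (Euc N)).toSphere)

end

end NonlocalBV

/-!
Write `κ = -γ / p > 1`, and let `L` be the upper limit of `Φ_t(u)` as `t → 0`.

The idea is to average over the level `t`. If `Φ_t(u) ≤ M` for `0 < t < δ`, then multiplying by
`ε t ^ (ε - 1)` and integrating over `(0, δ)` gives, by Tonelli,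
`ε / (p + ε) ∬ min(|Q u|, δ) ^ (p + ε) |x - y| ^ (γ - N) dx dy ≤ M δ ^ ε`.
If `u` is bounded, then `|Q u| ≤ δ` near the diagonal, because the exponent `1 + γ / p = 1 - κ` is
negative, so that there the minimum may be dropped (`setLIntegral_Q_rpow_le`). What remains is a
functional of Bourgain–Brezis–Mironescu type,
`ε / (p + ε) ∬_{|h| < r} |u(x + h) - u(x)| ^ (p + ε) |h| ^ (-N - p + ε (κ - 1)) dx dh ≤ M δ ^ ε`.
By Jensen's inequality it does not increase when `u` is replaced by a mollification `w`
(`lintegral_mollify_sub_rpow_le`). For the smooth function `w` one lets `ε → 0` with Fatou's lemma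
in polar coordinates (`K_gradient_le_liminf`), and the outcome is
`K / |γ| ∫ |∇w| ^ p ≤ M`. Truncation only decreases `Φ_t`, so the same bound follows for the
mollifications of an arbitrary `u` in `L^p`, with `L` in place of `M`
(`lintegral_gradient_mollify_le_limsup`).

It remains to remove the mollification. The total variation is a supremum of functionals which are
continuous along mollifications (`totalVariation_le_of_mollify`), which settles `p = 1`. For
`p > 1` the gradients of the mollifications are bounded in `L^p`, and one needs a weak limit of
them. It comes from a version of the Dunford–Pettis theorem, deduced from weak compactness of balls
in `L²` (`exists_tendsto_integral_mul`). The weak limit is a weak gradient `G` of `u`; the gradients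
of the mollifications of `u` are then the mollifications of `G` and converge to `G` almost
everywhere, so that Fatou's lemma gives the sharp bound (`exists_isWeakGradient_of_mollify`).

Finally `K p e` is positive, finite, and independent of the unit vector `e`: by polar coordinates it
is a multiple of the integral of `|e · x| ^ p` over the unit ball, which is invariant under
isometries.
-/

namespace NonlocalBV

/-! ### Polar coordinates and the constant `K` -/

lemma ofReal_abs_rpow {p : ℝ} (hp : 0 ≤ p) (a : ℝ) : ENNReal.ofReal (|a| ^ p) = ‖a‖ₑ ^ p := by
  rw [← ENNReal.ofReal_rpow_of_nonneg (abs_nonneg a) hp, ← Real.norm_eq_abs, ofReal_norm]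

lemma ofReal_norm_rpow {E : Type*} [SeminormedAddGroup E] {p : ℝ} (hp : 0 ≤ p) (a : E) :
    ENNReal.ofReal (‖a‖ ^ p) = ‖a‖ₑ ^ p := by
  rw [← ENNReal.ofReal_rpow_of_nonneg (norm_nonneg a) hp, ofReal_norm]

lemma nontrivial_euc {N : ℕ} (hN : 1 ≤ N) : Nontrivial (Euc N) :=
  Module.nontrivial_of_finrank_pos (R := ℝ) (by simp; omega)

/-- Integration in polar coordinates. -/
lemma lintegral_polar {N : ℕ} (hN : 1 ≤ N) {f : Euc N → ℝ≥0∞} (hf : Measurable f) :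
    ∫⁻ x, f x = ∫⁻ σ : Metric.sphere (0 : Euc N) 1, (∫⁻ s in Ioi (0 : ℝ),
      ENNReal.ofReal (s ^ (N - 1)) * f (s • (σ : Euc N)))
        ∂((volume : Measure (Euc N)).toSphere) := by
  have := nontrivial_euc hN
  have hm : Measurable fun z : Metric.sphere (0 : Euc N) 1 × ↥(Ioi (0 : ℝ)) =>
      f ((z.2 : ℝ) • (z.1 : Euc N)) := hf.comp (by fun_prop)
  calc ∫⁻ x, f x = ∫⁻ x in ({0}ᶜ : Set (Euc N)), f x := by rw [restrict_compl_singleton]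
    _ = ∫⁻ x : ({0}ᶜ : Set (Euc N)), f (x : Euc N) ∂((volume : Measure (Euc N)).comap Subtype.val) :=
      (lintegral_subtype_comap (measurableSet_singleton _).compl f).symm
    _ = ∫⁻ z : Metric.sphere (0 : Euc N) 1 × ↥(Ioi (0 : ℝ)), f ((z.2 : ℝ) • (z.1 : Euc N))
          ∂((volume : Measure (Euc N)).toSphere.prod (Measure.volumeIoiPow (N - 1))) := by
      have h := (volume : Measure (Euc N)).measurePreserving_homeomorphUnitSphereProd
      rw [finrank_euclideanSpace_fin] at h
      rw [← h.lintegral_comp hm]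
      refine lintegral_congr fun x => ?_
      have := (homeomorphUnitSphereProd (Euc N)).symm_apply_apply x
      rw [← homeomorphUnitSphereProd_symm_apply_coe, this]
    _ = _ := by
      rw [lintegral_prod _ hm.aemeasurable]
      refine lintegral_congr fun σ => ?_
      rw [Measure.volumeIoiPow, lintegral_withDensity_eq_lintegral_mul _ (by fun_prop)
        (show Measurable fun s : Ioi (0 : ℝ) =>
          f ((s : ℝ) • (σ : Euc N)) from hm.comp measurable_prodMk_left)]
      exact lintegral_subtype_comap measurableSet_Ioi
        (fun s : ℝ => ENNReal.ofReal (s ^ (N - 1)) * f (s • (σ : Euc N)))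

lemma K_eq {N : ℕ} {p : ℝ} (hp : 0 ≤ p) (a : Euc N) :
    K p a = ∫⁻ σ : Metric.sphere (0 : Euc N) 1, ‖inner ℝ a (σ : Euc N)‖ₑ ^ p
      ∂((volume : Measure (Euc N)).toSphere) := by
  simp only [K, ofReal_abs_rpow hp]

lemma K_smul {N : ℕ} {p : ℝ} (hp : 0 ≤ p) (c : ℝ) (a : Euc N) :
    K p (c • a) = ‖c‖ₑ ^ p * K p a := by
  rw [K_eq hp, K_eq hp, ← lintegral_const_mul _ (by fun_prop)]
  simp only [real_inner_smul_left, enorm_mul, ENNReal.mul_rpow_of_nonneg _ _ hp]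

lemma lintegral_rpow_Ioo {a r : ℝ} (ha : -1 < a) (hr : 0 ≤ r) :
    ∫⁻ s in Ioo 0 r, ENNReal.ofReal (s ^ a) = ENNReal.ofReal (r ^ (a + 1) / (a + 1)) := by
  have h1 : ∫⁻ s in Ioo 0 r, ENNReal.ofReal (s ^ a) = ∫⁻ s in Ioc 0 r, ENNReal.ofReal (s ^ a) := by
    rw [Measure.restrict_congr_set Ioo_ae_eq_Ioc]
  have hi : IntervalIntegrable (fun s : ℝ => s ^ a) volume 0 r :=
    intervalIntegral.intervalIntegrable_rpow' ha
  rw [h1, ← ofReal_integral_eq_lintegral_ofReal ((intervalIntegrable_iff_integrableOn_Ioc_of_le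
    hr).1 hi), ← intervalIntegral.integral_of_le hr, integral_rpow (Or.inl ha),
    Real.zero_rpow (by linarith), sub_zero]
  filter_upwards [ae_restrict_mem measurableSet_Ioc] with s hs
  exact Real.rpow_nonneg hs.1.le _

/-- The integral of `|a · x| ^ p` over the unit ball is a fixed multiple of `K p a`. As Lebesgue
measure is invariant under isometries, so is `K p`. -/
lemma lintegral_ball_inner {N : ℕ} (hN : 1 ≤ N) {p : ℝ} (hp : 0 ≤ p) (a : Euc N) :
    ∫⁻ x in Metric.ball (0 : Euc N) 1, ‖inner ℝ a x‖ₑ ^ p =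
      ENNReal.ofReal (1 / (N + p)) * K p a := by
  rw [← lintegral_indicator measurableSet_ball, lintegral_polar hN
    (Measurable.indicator (by fun_prop) measurableSet_ball), K_eq hp,
    ← lintegral_const_mul _ (by fun_prop)]
  refine lintegral_congr fun σ => ?_
  have hσ : ‖(σ : Euc N)‖ = 1 := by simp
  have h1 : ∫⁻ s in Ioo (0 : ℝ) 1, ENNReal.ofReal (s ^ ((N : ℝ) - 1 + p)) =
      ENNReal.ofReal (1 / (N + p)) := by
    have hN' : (1 : ℝ) ≤ N := by exact_mod_cast hN
    rw [lintegral_rpow_Ioo (by linarith) zero_le_one, Real.one_rpow]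
    congr 2; ring
  rw [← h1, ← lintegral_mul_const _ (by fun_prop), ← lintegral_indicator measurableSet_Ioi,
    ← lintegral_indicator measurableSet_Ioo]
  refine lintegral_congr fun s => ?_
  by_cases hs : 0 < s
  · by_cases hs1 : s < 1
    · have hN' : ((N - 1 : ℕ) : ℝ) = (N : ℝ) - 1 := by simp [Nat.cast_sub hN]
      have hmem : s • (σ : Euc N) ∈ Metric.ball (0 : Euc N) 1 := by
        simp [norm_smul, hσ, abs_of_pos hs, hs1]
      rw [indicator_of_mem (mem_Ioi.2 hs), indicator_of_mem hmem,
        indicator_of_mem (mem_Ioo.2 ⟨hs, hs1⟩), real_inner_smul_right, enorm_mul,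
        ENNReal.mul_rpow_of_nonneg _ _ hp, ← mul_assoc, Real.rpow_add hs, ← hN',
        Real.rpow_natCast, ENNReal.ofReal_mul (by positivity), ← ofReal_abs_rpow hp s,
        abs_of_pos hs]
    · have hmem : s • (σ : Euc N) ∉ Metric.ball (0 : Euc N) 1 := by
        simpa [norm_smul, hσ, abs_of_pos hs] using hs1
      rw [indicator_of_mem (mem_Ioi.2 hs), indicator_of_notMem hmem,
        indicator_of_notMem (by simp [hs1]), mul_zero]
  · rw [indicator_of_notMem (by simpa using hs), indicator_of_notMem (by simp [hs])]

lemma K_linearIsometryEquiv {N : ℕ} (hN : 1 ≤ N) {p : ℝ} (hp : 0 ≤ p)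
    (T : Euc N ≃ₗᵢ[ℝ] Euc N) (a : Euc N) : K p (T a) = K p a := by
  have h : ∫⁻ x in Metric.ball (0 : Euc N) 1, ‖inner ℝ (T a) x‖ₑ ^ p =
      ∫⁻ x in Metric.ball (0 : Euc N) 1, ‖inner ℝ a x‖ₑ ^ p := by
    rw [← lintegral_indicator measurableSet_ball, ← lintegral_indicator measurableSet_ball,
      ← T.measurePreserving.lintegral_comp (Measurable.indicator (by fun_prop) measurableSet_ball)]
    refine lintegral_congr fun x => ?_
    simp [indicator, T.inner_map_map]
  rw [lintegral_ball_inner hN hp, lintegral_ball_inner hN hp] at h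
  have : (0 : ℝ) < N := by exact_mod_cast hN
  refine (ENNReal.mul_right_inj ?_ ENNReal.ofReal_ne_top).1 h
  simp only [ne_eq, ENNReal.ofReal_eq_zero, not_le]
  positivity

lemma K_eq_norm_mul {N : ℕ} (hN : 1 ≤ N) {p : ℝ} (hp : 0 < p) {e : Euc N} (he : ‖e‖ = 1)
    (a : Euc N) : K p a = ‖a‖ₑ ^ p * K p e := by
  have h : ‖‖a‖ • e‖ = ‖a‖ := by simp [norm_smul, he]
  rw [← Submodule.reflection_sub h, K_linearIsometryEquiv hN hp.le, K_smul hp.le,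
    Submodule.reflection_sub h, enorm_norm]

lemma K_ne_zero {N : ℕ} {p : ℝ} (hp : 0 < p) {e : Euc N} (he : ‖e‖ = 1) : K p e ≠ 0 := by
  rw [K_eq hp.le, Ne, lintegral_eq_zero_iff (by fun_prop)]
  intro h
  have hopen : IsOpen {σ : Metric.sphere (0 : Euc N) 1 | inner ℝ e (σ : Euc N) ≠ 0} :=
    isOpen_ne_fun (by fun_prop) continuous_const
  refine hopen.measure_ne_zero ((volume : Measure (Euc N)).toSphere)
    ⟨⟨e, by simp [he]⟩, by simp [he]⟩ ?_
  refine measure_mono_null (fun σ hσ => ?_) h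
  simpa [hp, hp.le, not_lt.2 hp.le] using hσ

lemma K_ne_top {N : ℕ} {p : ℝ} (hp : 0 < p) {e : Euc N} (he : ‖e‖ = 1) : K p e ≠ ⊤ := by
  rw [K_eq hp.le]
  refine ne_top_of_le_ne_top (b := ∫⁻ _ : Metric.sphere (0 : Euc N) 1, 1
    ∂((volume : Measure (Euc N)).toSphere)) 
      (by rw [lintegral_one]; exact measure_ne_top _ _) (lintegral_mono fun σ => ?_)
  refine ENNReal.rpow_le_one ?_ hp.le
  have hσ : ‖(σ : Euc N)‖ = 1 := by simp
  have := norm_inner_le_norm (𝕜 := ℝ) e (σ : Euc N)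
  rw [he, hσ, mul_one] at this
  rw [← ofReal_norm]
  exact ENNReal.ofReal_le_one.2 this

end NonlocalBV

namespace NonlocalBV

/-! ### Averaging in the level: from `Φ_t` to a functional of Bourgain–Brezis–Mironescu type -/

lemma measurable_Q {N : ℕ} (b : ℝ) {v : Euc N → ℝ} (hv : Measurable v) : Measurable (Q b v) := by
  unfold Q; fun_prop

lemma lintegral_mul_rpow_Ioo {ε d : ℝ} (hε : 0 < ε) (hd : 0 ≤ d) :
    ∫⁻ t in Ioo 0 d, ENNReal.ofReal (ε * t ^ (ε - 1)) = ENNReal.ofReal (d ^ ε) := by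
  simp_rw [ENNReal.ofReal_mul hε.le]
  rw [lintegral_const_mul _ (by fun_prop), lintegral_rpow_Ioo (by linarith) hd,
    ← ENNReal.ofReal_mul hε.le]
  congr 1
  rw [sub_add_cancel]
  field_simp

lemma ofReal_mul_rpow_le_lintegral {ε p d δ : ℝ} (hε : 0 < ε) (hp : 0 ≤ p) (hd : 0 ≤ d)
    (hdδ : d ≤ δ) :
    ENNReal.ofReal (ε / (p + ε)) * ENNReal.ofReal (d ^ (p + ε)) ≤
      ∫⁻ t in Ioo 0 δ, ENNReal.ofReal (ε * t ^ (ε - 1)) *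
        (ENNReal.ofReal (t ^ p) * (Iio d).indicator 1 t) := by
  have h1 : ∫⁻ t in Ioo 0 d, ENNReal.ofReal ε * ENNReal.ofReal (t ^ (ε - 1 + p)) =
      ENNReal.ofReal (ε / (p + ε)) * ENNReal.ofReal (d ^ (p + ε)) := by
    rw [lintegral_const_mul _ (by fun_prop), lintegral_rpow_Ioo (by linarith) hd,
      ← ENNReal.ofReal_mul hε.le, ← ENNReal.ofReal_mul (by positivity)]
    congr 1
    rw [show ε - 1 + p + 1 = p + ε by ring]
    ring
  rw [← h1]
  refine le_trans (le_of_eq (setLIntegral_congr_fun measurableSet_Ioo fun t ht => ?_))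
    (lintegral_mono_set (Ioo_subset_Ioo_right hdδ))
  simp only [indicator_of_mem (mem_Iio.2 ht.2), Pi.one_apply, mul_one]
  rw [Real.rpow_add ht.1, ENNReal.ofReal_mul hε.le, ENNReal.ofReal_mul (Real.rpow_nonneg ht.1.le _),
    mul_assoc]

/-- If `Φ_t(v) ≤ M` for all small `t`, integrating against the probability density proportional to
`t ^ (ε - 1)` on `(0, δ)` bounds a double integral of a power of the difference quotient. The
quotient has to be at most `δ` on the domain of integration for the cut-off at `δ` to be
invisible. -/
lemma setLIntegral_Q_rpow_le {N : ℕ} {p γ δ ε : ℝ} (hp : 0 ≤ p) (hε : 0 < ε) (hδ : 0 ≤ δ)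
    {v : Euc N → ℝ} (hv : Measurable v) {M : ℝ≥0∞}
    (hM : ∀ t ∈ Ioo 0 δ, PhiLevel p γ t v ≤ M) {A : Set (Euc N × Euc N)}
    (hA : MeasurableSet A) (hAδ : ∀ z ∈ A, |Q (γ / p) v z| ≤ δ) :
    ∫⁻ z in A, ENNReal.ofReal (ε / (p + ε)) * (‖Q (γ / p) v z‖ₑ ^ (p + ε) *
      ENNReal.ofReal (‖z.1 - z.2‖ ^ (-(N : ℝ) + γ))) ≤ M * ENNReal.ofReal (δ ^ ε) := by
  have hQ := measurable_Q (γ / p) hv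
  set w : Euc N × Euc N → ℝ≥0∞ := fun z => ENNReal.ofReal (‖z.1 - z.2‖ ^ (-(N : ℝ) + γ)) with hw
  have hwm : Measurable w := by fun_prop
  have hS : MeasurableSet {y : (Euc N × Euc N) × ℝ | y.2 < |Q (γ / p) v y.1|} :=
    measurableSet_lt measurable_snd ((continuous_abs.measurable.comp hQ).comp measurable_fst)
  set I : (Euc N × Euc N) → ℝ → ℝ≥0∞ := fun z t => (Iio |Q (γ / p) v z|).indicator 1 t
  have hI : Measurable (Function.uncurry I) := by
    have : Function.uncurry I =
        {y : (Euc N × Euc N) × ℝ | y.2 < |Q (γ / p) v y.1|}.indicator 1 := by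
      ext y; simp [I, Function.uncurry, indicator]
    rw [this]
    exact measurable_one.indicator hS
  have hI' : Measurable fun y : (Euc N × Euc N) × ℝ => I y.1 y.2 := hI
  calc ∫⁻ z in A, ENNReal.ofReal (ε / (p + ε)) * (‖Q (γ / p) v z‖ₑ ^ (p + ε) * w z)
      ≤ ∫⁻ z in A, ∫⁻ t in Ioo 0 δ, ENNReal.ofReal (ε * t ^ (ε - 1)) *
          (ENNReal.ofReal (t ^ p) * I z t) * w z := by
        refine setLIntegral_mono' hA fun z hz => ?_
        rw [lintegral_mul_const _ (by
          have := hI.comp (measurable_prodMk_left (x := z))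
          have h2 : Measurable (I z) := this
          fun_prop), ← mul_assoc, ← ofReal_abs_rpow (by linarith)]
        gcongr
        exact ofReal_mul_rpow_le_lintegral hε hp (abs_nonneg _) (hAδ z hz)
    _ ≤ ∫⁻ z, ∫⁻ t in Ioo 0 δ, ENNReal.ofReal (ε * t ^ (ε - 1)) *
          (ENNReal.ofReal (t ^ p) * I z t) * w z := setLIntegral_le_lintegral _ _
    _ = ∫⁻ t in Ioo 0 δ, ∫⁻ z, ENNReal.ofReal (ε * t ^ (ε - 1)) *
          (ENNReal.ofReal (t ^ p) * I z t) * w z := by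
        refine lintegral_lintegral_swap (Measurable.aemeasurable ?_)
        simp only [Function.uncurry_def]
        fun_prop
    _ = ∫⁻ t in Ioo 0 δ, ENNReal.ofReal (ε * t ^ (ε - 1)) * PhiLevel p γ t v := by
        refine lintegral_congr fun t => ?_
        have hE : MeasurableSet (superlevel t (γ / p) v) :=
          measurableSet_lt measurable_const (continuous_abs.measurable.comp hQ)
        rw [PhiLevel, nu, ← lintegral_indicator hE,
          ← lintegral_const_mul _ (hwm.indicator hE), ← lintegral_const_mul _
            ((hwm.indicator hE).const_mul _)]
        refine lintegral_congr fun z => ?_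
        by_cases hz : t < |Q (γ / p) v z|
        · rw [indicator_of_mem (show z ∈ superlevel t (γ / p) v from hz)]
          simp only [I, indicator_of_mem (mem_Iio.2 hz), Pi.one_apply, mul_one, mul_assoc, hw]
        · rw [indicator_of_notMem (show z ∉ superlevel t (γ / p) v from hz)]
          simp only [I, indicator_of_notMem (show t ∉ Iio _ from hz), mul_zero, zero_mul]
    _ ≤ ∫⁻ t in Ioo 0 δ, ENNReal.ofReal (ε * t ^ (ε - 1)) * M :=
        setLIntegral_mono' measurableSet_Ioo fun t ht => by gcongr; exact hM t ht
    _ = M * ENNReal.ofReal (δ ^ ε) := by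
        rw [lintegral_mul_const _ (by fun_prop), lintegral_mul_rpow_Ioo hε hδ, mul_comm]

/-- The double integral of a power of the difference quotient, written in terms of the increments
of `v` by a vector `h`. -/
lemma setLIntegral_Q_rpow_eq {N : ℕ} (hN : 1 ≤ N) {b c q r : ℝ} (hq : 0 < q) {v : Euc N → ℝ}
    (hv : Measurable v) :
    ∫⁻ z in {z : Euc N × Euc N | ‖z.1 - z.2‖ < r}, ‖Q b v z‖ₑ ^ q *
        ENNReal.ofReal (‖z.1 - z.2‖ ^ c) =
      ∫⁻ h in Metric.ball (0 : Euc N) r, ENNReal.ofReal (‖h‖ ^ (c - (1 + b) * q)) *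
        ∫⁻ y, ‖v (y + h) - v y‖ₑ ^ q := by
  have := nontrivial_euc hN
  have hQ := measurable_Q b hv
  have hA : MeasurableSet {z : Euc N × Euc N | ‖z.1 - z.2‖ < r} :=
    measurableSet_lt (by fun_prop) measurable_const
  set f : Euc N × Euc N → ℝ≥0∞ := {z : Euc N × Euc N | ‖z.1 - z.2‖ < r}.indicator
    fun z => ‖Q b v z‖ₑ ^ q * ENNReal.ofReal (‖z.1 - z.2‖ ^ c) with hf
  have hfm : Measurable f := Measurable.indicator (by fun_prop) hA
  calc _ = ∫⁻ z, f z := (lintegral_indicator hA _).symm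
    _ = ∫⁻ y, ∫⁻ x, f (x, y) := lintegral_prod_symm' _ hfm
    _ = ∫⁻ y, ∫⁻ h, f (y + h, y) := lintegral_congr fun y =>
        (lintegral_add_left_eq_self (fun x => f (x, y)) y).symm
    _ = ∫⁻ h, ∫⁻ y, f (y + h, y) :=
        lintegral_lintegral_swap (hfm.comp (by fun_prop : Measurable fun z : Euc N × Euc N =>
          (z.1 + z.2, z.1))).aemeasurable
    _ = _ := by
        rw [← lintegral_indicator measurableSet_ball]
        -- the powers of `‖h‖` are combined for `h ≠ 0`, which excludes only a null set
        have h0 : ∀ᵐ h : Euc N, h ≠ 0 := by simp [ae_iff, measure_singleton]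
        refine lintegral_congr_ae (h0.mono fun h hh => ?_)
        by_cases hr : ‖h‖ < r
        · have hh' : 0 < ‖h‖ := norm_pos_iff.2 hh
          simp only [indicator_of_mem (show h ∈ Metric.ball (0 : Euc N) r by simpa using hr)]
          rw [← lintegral_const_mul _ (by fun_prop)]
          refine lintegral_congr fun y => ?_
          rw [hf, indicator_of_mem (by simpa using hr)]
          simp only [Q, add_sub_cancel_left]
          rw [← ofReal_abs_rpow hq.le, ← ofReal_abs_rpow hq.le, ← ENNReal.ofReal_mul (by positivity),
            ← ENNReal.ofReal_mul (by positivity), abs_div, abs_of_pos (Real.rpow_pos_of_pos hh' _),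
            Real.div_rpow (abs_nonneg _) (by positivity), ← Real.rpow_mul hh'.le,
            Real.rpow_sub hh']
          congr 1
          field_simp
        · simp only [indicator_of_notMem (show h ∉ Metric.ball (0 : Euc N) r by simpa using hr)]
          simp [hf, hr]

/-! ### Mollification -/

open Convolution in
/-- The convolution of `v` with a bump function of integral one. -/
noncomputable def mollify {N : ℕ} (ρ : ContDiffBump (0 : Euc N)) (v : Euc N → ℝ) : Euc N → ℝ :=
  ρ.normed volume ⋆[ContinuousLinearMap.lsmul ℝ ℝ, volume] v

lemma mollify_apply {N : ℕ} (ρ : ContDiffBump (0 : Euc N)) (v : Euc N → ℝ) (x : Euc N) :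
    mollify ρ v x = ∫ t, ρ.normed volume t * v (x - t) := rfl

lemma integrable_mollify {N : ℕ} (ρ : ContDiffBump (0 : Euc N)) {v : Euc N → ℝ}
    (hv : LocallyIntegrable v) (x : Euc N) :
    Integrable fun t => ρ.normed volume t * v (x - t) :=
  ρ.hasCompactSupport_normed.convolutionExists_left (ContinuousLinearMap.lsmul ℝ ℝ)
    ρ.continuous_normed hv x

/-- Jensen's inequality for the power `q ≥ 1` of a nonnegative function. -/
lemma lintegral_rpow_le_of_isProbabilityMeasure {α : Type*} [MeasurableSpace α] {μ : Measure α}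
    [IsProbabilityMeasure μ] {f : α → ℝ≥0∞} (hf : AEMeasurable f μ) {q : ℝ} (hq : 1 ≤ q) :
    (∫⁻ x, f x ∂μ) ^ q ≤ ∫⁻ x, f x ^ q ∂μ := by
  have h0 : 0 < q := by linarith
  have h := eLpNorm_le_eLpNorm_of_exponent_le (μ := μ) (p := 1) (q := ENNReal.ofReal q)
    (by simpa using ENNReal.ofReal_le_ofReal hq) hf.aestronglyMeasurable
  rw [eLpNorm_one_eq_lintegral_enorm, eLpNorm_eq_lintegral_rpow_enorm_toReal
    (by simpa using h0) ENNReal.ofReal_ne_top, ENNReal.toReal_ofReal h0.le] at h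
  calc (∫⁻ x, f x ∂μ) ^ q ≤ ((∫⁻ x, f x ^ q ∂μ) ^ (1 / q)) ^ q := by
        gcongr; simpa using h
    _ = _ := by rw [← ENNReal.rpow_mul, one_div_mul_cancel h0.ne', ENNReal.rpow_one]

/-- By Jensen's inequality, mollification does not increase the `L^q` norm of an increment. -/
lemma lintegral_mollify_sub_rpow_le {N : ℕ} (ρ : ContDiffBump (0 : Euc N)) {v : Euc N → ℝ}
    (hv : Measurable v) (hvl : LocallyIntegrable v) {q : ℝ} (hq : 1 ≤ q) (h : Euc N) :
    ∫⁻ y, ‖mollify ρ v (y + h) - mollify ρ v y‖ₑ ^ q ≤ ∫⁻ y, ‖v (y + h) - v y‖ₑ ^ q := by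
  set P : Measure (Euc N) := volume.withDensity fun t => ENNReal.ofReal (ρ.normed volume t) with hP
  have hρm : Measurable fun t => ENNReal.ofReal (ρ.normed volume t) :=
    ENNReal.measurable_ofReal.comp ρ.continuous_normed.measurable
  have : IsProbabilityMeasure P := by
    refine ⟨?_⟩
    rw [hP, withDensity_apply _ MeasurableSet.univ, setLIntegral_univ,
      ← ofReal_integral_eq_lintegral_ofReal ρ.integrable_normed (ae_of_all _ ρ.nonneg_normed),
      ρ.integral_normed, ENNReal.ofReal_one]
  have h1 : ∀ y, ‖mollify ρ v (y + h) - mollify ρ v y‖ₑ ≤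
      ∫⁻ t, ‖v (y + h - t) - v (y - t)‖ₑ ∂P := by
    intro y
    rw [mollify_apply, mollify_apply, ← integral_sub (integrable_mollify ρ hvl _)
      (integrable_mollify ρ hvl _), hP, lintegral_withDensity_eq_lintegral_mul _ hρm (by fun_prop)]
    refine (enorm_integral_le_lintegral_enorm _).trans (lintegral_mono fun t => ?_)
    rw [← mul_sub, enorm_mul, Pi.mul_apply, Real.enorm_of_nonneg (ρ.nonneg_normed t)]
  calc _ ≤ ∫⁻ y, ∫⁻ t, ‖v (y + h - t) - v (y - t)‖ₑ ^ q ∂P := by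
        refine lintegral_mono fun y => ?_
        refine (ENNReal.rpow_le_rpow (h1 y) (by linarith)).trans ?_
        exact lintegral_rpow_le_of_isProbabilityMeasure (by fun_prop) hq
    _ = ∫⁻ t, (∫⁻ y, ‖v (y + h - t) - v (y - t)‖ₑ ^ q) ∂P :=
        lintegral_lintegral_swap (by fun_prop)
    _ = ∫⁻ _, (∫⁻ y, ‖v (y + h) - v y‖ₑ ^ q) ∂P := by
        refine lintegral_congr fun t => ?_
        rw [← lintegral_sub_right_eq_self (fun y => ‖v (y + h) - v y‖ₑ ^ q) t]
        refine lintegral_congr fun y => ?_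
        rw [show y + h - t = y - t + h by abel]
    _ = _ := by simp

end NonlocalBV

namespace NonlocalBV

open scoped Gradient

/-! ### The lower bound for smooth functions -/

lemma tendsto_one_div_nat_succ : Tendsto (fun n : ℕ => 1 / ((n : ℝ) + 1)) atTop (𝓝 0) :=
  tendsto_one_div_add_atTop_nhds_zero_nat

/-- As `ε → 0`, the measures `ε s ^ (κ ε - 1) ds` on `(0, r)` concentrate at `0`, with total mass
tending to `1 / κ`. -/
lemma rpow_div_le_liminf {p κ r A : ℝ} (hp : 1 ≤ p) (hκ : 0 < κ) (hr : 0 < r) (hA : 0 ≤ A)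
    {φ : ℝ → ℝ} (hφ : Tendsto φ (𝓝[>] 0) (𝓝 A)) {ε : ℕ → ℝ} (hε : ∀ n, 0 < ε n)
    (hε0 : Tendsto ε atTop (𝓝 0)) :
    ENNReal.ofReal (A ^ p / (κ * p)) ≤ liminf (fun n => ENNReal.ofReal (ε n / (p + ε n)) *
      ∫⁻ s in Ioo 0 r, ENNReal.ofReal (s ^ (κ * ε n - 1)) * ENNReal.ofReal (φ s) ^ (p + ε n))
      atTop := by
  have hp0 : 0 < p := by linarith
  set F : ℝ → ℝ≥0∞ := fun τ => ENNReal.ofReal (τ ^ p / (κ * p)) with hF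
  have key : ∀ τ, 0 < τ → τ < A → F τ ≤ liminf (fun n => ENNReal.ofReal (ε n / (p + ε n)) *
      ∫⁻ s in Ioo 0 r, ENNReal.ofReal (s ^ (κ * ε n - 1)) * ENNReal.ofReal (φ s) ^ (p + ε n))
      atTop := by
    intro τ hτ hτA
    obtain ⟨s₀, hs₀, hs⟩ := mem_nhdsGT_iff_exists_Ioo_subset.1 (hφ.eventually (lt_mem_nhds hτA))
    -- on `(0, d)` the integrand is at least `τ ^ (p + ε) * s ^ (κ * ε - 1)`
    set d := min s₀ r
    have hd : 0 < d := lt_min hs₀ hr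
    have hlim : Tendsto (fun n => ENNReal.ofReal (τ ^ (p + ε n) * d ^ (κ * ε n) /
        (κ * (p + ε n)))) atTop (𝓝 (F τ)) := by
      refine ENNReal.tendsto_ofReal ?_
      have h1 : Tendsto (fun n => p + ε n) atTop (𝓝 p) := by simpa using hε0.const_add p
      have h2 : Tendsto (fun n => κ * ε n) atTop (𝓝 0) := by simpa using hε0.const_mul κ
      have h3 : Tendsto (fun n => τ ^ (p + ε n)) atTop (𝓝 (τ ^ p)) :=
        tendsto_const_nhds.rpow h1 (Or.inl hτ.ne')
      have h4 : Tendsto (fun n => d ^ (κ * ε n)) atTop (𝓝 1) := by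
        simpa using tendsto_const_nhds.rpow h2 (Or.inl hd.ne') (f := fun _ : ℕ => d)
      have h5 := (h3.mul h4).div (h1.const_mul κ) (by positivity)
      rw [mul_one] at h5
      exact h5
    rw [← hlim.liminf_eq]
    refine liminf_le_liminf (Eventually.of_forall fun n => ?_)
    have hεn := hε n
    have hInt : ∫⁻ s in Ioo 0 d, ENNReal.ofReal (s ^ (κ * ε n - 1)) *
        ENNReal.ofReal τ ^ (p + ε n) =
        ENNReal.ofReal (d ^ (κ * ε n) / (κ * ε n)) * ENNReal.ofReal τ ^ (p + ε n) := by
      have : 0 < κ * ε n := by positivity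
      rw [lintegral_mul_const _ (by fun_prop), lintegral_rpow_Ioo (by linarith) hd.le,
        sub_add_cancel]
    calc ENNReal.ofReal (τ ^ (p + ε n) * d ^ (κ * ε n) / (κ * (p + ε n)))
        = ENNReal.ofReal (ε n / (p + ε n)) * ∫⁻ s in Ioo 0 d,
            ENNReal.ofReal (s ^ (κ * ε n - 1)) * ENNReal.ofReal τ ^ (p + ε n) := by
          rw [hInt, ENNReal.ofReal_rpow_of_pos hτ, ← ENNReal.ofReal_mul (by positivity),
            ← ENNReal.ofReal_mul (by positivity)]
          congr 1
          field_simp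
      _ ≤ ENNReal.ofReal (ε n / (p + ε n)) * ∫⁻ s in Ioo 0 d,
            ENNReal.ofReal (s ^ (κ * ε n - 1)) * ENNReal.ofReal (φ s) ^ (p + ε n) := by
          gcongr ENNReal.ofReal (ε n / (p + ε n)) * ?_
          refine setLIntegral_mono' measurableSet_Ioo fun s hs' => ?_
          gcongr
          exact (hs ⟨hs'.1, hs'.2.trans_le (min_le_left _ _)⟩ : τ < φ s).le
      _ ≤ _ := by
          gcongr
          exact min_le_right _ _
  rcases hA.eq_or_lt with rfl | hA
  · simp [Real.zero_rpow hp0.ne']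
  · have hcont : Tendsto F (𝓝[<] A) (𝓝 (F A)) := by
      refine Tendsto.mono_left ?_ nhdsWithin_le_nhds
      refine ENNReal.tendsto_ofReal ?_
      exact ((Real.continuousAt_rpow_const A p (Or.inl hA.ne')).div_const _)
    refine le_of_tendsto hcont ?_
    filter_upwards [Ioo_mem_nhdsLT hA] with τ hτ using key τ hτ.1 hτ.2

lemma tendsto_abs_slope {N : ℕ} {w : Euc N → ℝ} {x : Euc N} (hw : DifferentiableAt ℝ w x)
    (σ : Euc N) :
    Tendsto (fun s : ℝ => |w (x + s • σ) - w x| / s) (𝓝[>] 0) (𝓝 |inner ℝ (∇ w x) σ|) := by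
  have h1 : HasDerivAt (fun t : ℝ => w (x + t • σ)) (fderiv ℝ w x σ) 0 :=
    hw.hasFDerivAt.hasLineDerivAt σ
  have h2 := h1.tendsto_slope_zero_right.abs
  have h3 : inner ℝ (∇ w x) σ = fderiv ℝ w x σ := by
    rw [gradient, InnerProductSpace.toDual_symm_apply]
  rw [h3]
  refine h2.congr' ?_
  filter_upwards [self_mem_nhdsWithin] with s hs
  have hs : 0 < s := hs
  simp only [zero_add, zero_smul, add_zero, smul_eq_mul]
  rw [abs_mul, abs_inv, abs_of_pos hs]
  ring

/-- The localised functional at a point `x` of differentiability controls, in the limit `ε → 0`, the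
integral of `|∇w(x) · σ| ^ p` over the unit sphere. -/
lemma K_gradient_le_liminf {N : ℕ} (hN : 1 ≤ N) {p κ r : ℝ} (hp : 1 ≤ p) (hκ : 0 < κ)
    (hr : 0 < r) {w : Euc N → ℝ} (hwc : Continuous w) {x : Euc N} (hw : DifferentiableAt ℝ w x)
    {ε : ℕ → ℝ} (hε : ∀ n, 0 < ε n) (hε0 : Tendsto ε atTop (𝓝 0)) :
    K p (∇ w x) / ENNReal.ofReal (κ * p) ≤ liminf (fun n => ENNReal.ofReal (ε n / (p + ε n)) *
      ∫⁻ h in Metric.ball (0 : Euc N) r,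
        ENNReal.ofReal (‖h‖ ^ (-(N : ℝ) - κ * p - (1 - κ) * (p + ε n))) *
          ‖w (x + h) - w x‖ₑ ^ (p + ε n)) atTop := by
  have hp0 : 0 < p := by linarith
  have hwm := hwc.measurable
  set G : ℕ → Metric.sphere (0 : Euc N) 1 → ℝ≥0∞ := fun n σ =>
    ENNReal.ofReal (ε n / (p + ε n)) * ∫⁻ s in Ioo 0 r, ENNReal.ofReal (s ^ (κ * ε n - 1)) *
      ENNReal.ofReal (|w (x + s • (σ : Euc N)) - w x| / s) ^ (p + ε n) with hG
  have hGm : ∀ n, Measurable (G n) := by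
    intro n
    refine Measurable.const_mul ?_ _
    refine Measurable.lintegral_prod_right' (f := fun z : Metric.sphere (0 : Euc N) 1 × ℝ =>
      ENNReal.ofReal (z.2 ^ (κ * ε n - 1)) *
      ENNReal.ofReal (|w (x + z.2 • (z.1 : Euc N)) - w x| / z.2) ^ (p + ε n)) ?_
    have h1 : Measurable fun z : Metric.sphere (0 : Euc N) 1 × ℝ =>
        w (x + z.2 • (z.1 : Euc N)) := hwm.comp (by fun_prop)
    have h2 : Measurable fun z : Metric.sphere (0 : Euc N) 1 × ℝ =>
        |w (x + z.2 • (z.1 : Euc N)) - w x| :=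
      continuous_abs.measurable.comp (h1.sub_const _)
    fun_prop
  have hpolar : ∀ n, ENNReal.ofReal (ε n / (p + ε n)) *
      ∫⁻ h in Metric.ball (0 : Euc N) r,
        ENNReal.ofReal (‖h‖ ^ (-(N : ℝ) - κ * p - (1 - κ) * (p + ε n))) *
          ‖w (x + h) - w x‖ₑ ^ (p + ε n) =
      ∫⁻ σ, G n σ ∂((volume : Measure (Euc N)).toSphere) := by
    intro n
    have hεn := hε n
    have hwm' : Measurable fun h => w (x + h) - w x :=
      (hwm.comp (measurable_const_add x)).sub_const _
    rw [lintegral_const_mul' _ _ ENNReal.ofReal_ne_top, ← lintegral_indicator measurableSet_ball,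
      lintegral_polar hN (Measurable.indicator (by fun_prop) measurableSet_ball)]
    congr 1
    refine lintegral_congr fun σ => ?_
    have hσ : ‖(σ : Euc N)‖ = 1 := by simp
    rw [← lintegral_indicator measurableSet_Ioi, ← lintegral_indicator measurableSet_Ioo]
    refine lintegral_congr fun s => ?_
    by_cases hs : 0 < s
    · rw [indicator_of_mem (mem_Ioi.2 hs)]
      have hns : ‖s • (σ : Euc N)‖ = s := by simp [norm_smul, hσ, abs_of_pos hs]
      by_cases hsr : s < r
      · have hN' : ((N - 1 : ℕ) : ℝ) = (N : ℝ) - 1 := by simp [Nat.cast_sub hN]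
        rw [indicator_of_mem (by simpa [hns] using hsr), indicator_of_mem (mem_Ioo.2 ⟨hs, hsr⟩),
          hns, ← ofReal_abs_rpow (by linarith), ENNReal.ofReal_rpow_of_nonneg (by positivity)
          (by linarith), ← ENNReal.ofReal_mul (by positivity), ← ENNReal.ofReal_mul (by positivity),
          ← ENNReal.ofReal_mul (by positivity), Real.div_rpow (abs_nonneg _) hs.le,
          ← Real.rpow_natCast, hN', ← mul_assoc, ← Real.rpow_add hs, div_eq_mul_inv,
          ← Real.rpow_neg hs.le, mul_comm (|_| ^ _) (s ^ _), ← mul_assoc, ← Real.rpow_add hs]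
        congr 3
        ring
      · rw [indicator_of_notMem (by simpa [hns] using hsr), indicator_of_notMem (by simp [hsr]),
          mul_zero]
    · rw [indicator_of_notMem (by simpa using hs), indicator_of_notMem (by simp [hs])]
  simp_rw [hpolar]
  refine le_trans ?_ (lintegral_liminf_le hGm)
  rw [K_eq hp0.le, div_eq_mul_inv, ← lintegral_mul_const _ (by fun_prop)]
  refine lintegral_mono fun σ => ?_
  have h := rpow_div_le_liminf hp hκ hr (abs_nonneg _) (tendsto_abs_slope hw (σ : Euc N)) hε hε0
  rwa [ENNReal.ofReal_div_of_pos (by positivity), ofReal_abs_rpow hp0.le] at h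

end NonlocalBV

namespace NonlocalBV

open scoped Gradient

/-! ### The lower bound for mollifications -/

lemma contDiff_mollify {N : ℕ} (ρ : ContDiffBump (0 : Euc N)) {v : Euc N → ℝ}
    (hv : LocallyIntegrable v) : ContDiff ℝ ∞ (mollify ρ v) :=
  ρ.hasCompactSupport_normed.contDiff_convolution_left (ContinuousLinearMap.lsmul ℝ ℝ)
    ρ.contDiff_normed hv

lemma differentiable_mollify {N : ℕ} (ρ : ContDiffBump (0 : Euc N)) {v : Euc N → ℝ}
    (hv : LocallyIntegrable v) : Differentiable ℝ (mollify ρ v) :=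
  (contDiff_mollify ρ hv).differentiable (by simp)

lemma continuous_gradient_mollify {N : ℕ} (ρ : ContDiffBump (0 : Euc N)) {v : Euc N → ℝ}
    (hv : LocallyIntegrable v) : Continuous (∇ (mollify ρ v)) :=
  (InnerProductSpace.toDual ℝ (Euc N)).symm.continuous.comp
    ((contDiff_mollify ρ hv).continuous_fderiv (by simp))

lemma locallyIntegrable_of_bounded {N : ℕ} {v : Euc N → ℝ} (hv : Measurable v) {k : ℝ}
    (hk : ∀ x, |v x| ≤ k) : LocallyIntegrable v :=
  (memLp_top_of_bound hv.aestronglyMeasurable k (ae_of_all _ hk)).locallyIntegrable le_top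

/-- The lower bound for a mollification of a bounded function. Boundedness makes the difference
quotient small near the diagonal, because `1 + γ / p < 0`. -/
lemma lintegral_gradient_mollify_le_of_bounded {N : ℕ} (hN : 1 ≤ N) {p γ δ k : ℝ} (hp : 1 ≤ p)
    (hγ : γ < -p) (hδ : 0 < δ) {v : Euc N → ℝ} (hv : Measurable v) (hk : ∀ x, |v x| ≤ k)
    {M : ℝ≥0∞} (hM : ∀ t ∈ Ioo 0 δ, PhiLevel p γ t v ≤ M) (ρ : ContDiffBump (0 : Euc N))
    {e : Euc N} (he : ‖e‖ = 1) :
    K p e / ENNReal.ofReal |γ| * ∫⁻ x, ‖∇ (mollify ρ v) x‖ₑ ^ p ≤ M := by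
  have hp0 : 0 < p := by linarith
  have hvl := locallyIntegrable_of_bounded hv hk
  have hk0 : 0 ≤ k := (abs_nonneg _).trans (hk 0)
  obtain ⟨κ, hκ1, rfl⟩ : ∃ κ : ℝ, 1 < κ ∧ γ = -(κ * p) :=
    ⟨-γ / p, by rw [lt_div_iff₀ hp0]; linarith, by field_simp⟩
  have hb : -(κ * p) / p = -κ := by field_simp
  have hκ : 0 < κ := by linarith
  have habs : |-(κ * p)| = κ * p := by rw [abs_neg, abs_of_pos (by positivity)]
  -- the radius is chosen so that `2 * k * r ^ (κ - 1) ≤ δ`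
  set r : ℝ := (δ / (2 * k + 1)) ^ (1 / (κ - 1)) with hr_def
  have hr : 0 < r := by positivity
  have hrk : 2 * k * r ^ (κ - 1) ≤ δ := by
    rw [hr_def, ← Real.rpow_mul (by positivity), one_div_mul_cancel (by linarith), Real.rpow_one,
      mul_div_assoc', div_le_iff₀ (by positivity)]
    nlinarith
  set A : Set (Euc N × Euc N) := {z | ‖z.1 - z.2‖ < r}
  have hA : MeasurableSet A := measurableSet_lt (by fun_prop) measurable_const
  have hAδ : ∀ z ∈ A, |Q (-(κ * p) / p) v z| ≤ δ := by
    intro z hz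
    have hz : ‖z.1 - z.2‖ < r := hz
    rw [hb, Q, show 1 + -κ = -(κ - 1) by ring, Real.rpow_neg (norm_nonneg _), div_inv_eq_mul,
      abs_mul, abs_of_nonneg (Real.rpow_nonneg (norm_nonneg _) _)]
    refine le_trans ?_ hrk
    have h1 : |v z.1 - v z.2| ≤ 2 * k := by
      linarith [abs_sub (v z.1) (v z.2), hk z.1, hk z.2]
    have h2 : ‖z.1 - z.2‖ ^ (κ - 1) ≤ r ^ (κ - 1) :=
      Real.rpow_le_rpow (norm_nonneg _) hz.le (by linarith)
    exact mul_le_mul h1 h2 (by positivity) (by positivity)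
  set ε : ℕ → ℝ := fun n => 1 / ((n : ℝ) + 1) with hε_def
  have hε : ∀ n, 0 < ε n := fun n => by positivity
  have hε0 : Tendsto ε atTop (𝓝 0) := tendsto_one_div_nat_succ
  set w := mollify ρ v with hw
  have hwd := differentiable_mollify ρ hvl
  have hwm : Measurable w := hwd.continuous.measurable
  set W : ℕ → Euc N → ℝ≥0∞ := fun n h =>
    ENNReal.ofReal (‖h‖ ^ (-(N : ℝ) - κ * p - (1 - κ) * (p + ε n))) with hW
  have hWm : ∀ n, Measurable (W n) := fun n => by fun_prop
  have hbound : ∀ n, ∫⁻ x, ENNReal.ofReal (ε n / (p + ε n)) *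
      ∫⁻ h in Metric.ball (0 : Euc N) r, W n h * ‖w (x + h) - w x‖ₑ ^ (p + ε n) ≤
        M * ENNReal.ofReal (δ ^ ε n) := by
    intro n
    have hεn := hε n
    have hq : 1 ≤ p + ε n := by linarith
    have hE : Measurable fun z : Euc N × Euc N => W n z.2 * ‖w (z.1 + z.2) - w z.1‖ₑ ^ (p + ε n) := by
      have h1 : Measurable fun z : Euc N × Euc N => w (z.1 + z.2) - w z.1 :=
        (hwm.comp (by fun_prop)).sub (hwm.comp measurable_fst)
      exact ((hWm n).comp measurable_snd).mul (h1.enorm.pow_const _)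
    calc _ = ENNReal.ofReal (ε n / (p + ε n)) * ∫⁻ x,
          ∫⁻ h in Metric.ball (0 : Euc N) r, W n h * ‖w (x + h) - w x‖ₑ ^ (p + ε n) :=
        lintegral_const_mul' _ _ ENNReal.ofReal_ne_top
      _ = ENNReal.ofReal (ε n / (p + ε n)) * ∫⁻ h in Metric.ball (0 : Euc N) r,
          W n h * ∫⁻ x, ‖w (x + h) - w x‖ₑ ^ (p + ε n) := by
        rw [lintegral_lintegral_swap hE.aemeasurable]
        congr 1
        refine lintegral_congr fun h => ?_
        rw [lintegral_const_mul]
        exact ((hwm.comp (measurable_add_const h)).sub hwm).enorm.pow_const _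
      _ ≤ ENNReal.ofReal (ε n / (p + ε n)) * ∫⁻ h in Metric.ball (0 : Euc N) r,
          W n h * ∫⁻ x, ‖v (x + h) - v x‖ₑ ^ (p + ε n) := by
        gcongr ENNReal.ofReal (ε n / (p + ε n)) * ?_
        refine lintegral_mono fun h => ?_
        gcongr W n h * ?_
        exact lintegral_mollify_sub_rpow_le ρ hv hvl hq h
      _ = ENNReal.ofReal (ε n / (p + ε n)) * ∫⁻ z in A, ‖Q (-(κ * p) / p) v z‖ₑ ^ (p + ε n) *
          ENNReal.ofReal (‖z.1 - z.2‖ ^ (-(N : ℝ) + -(κ * p))) := by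
        rw [setLIntegral_Q_rpow_eq hN (by linarith) hv]
        simp only [hW, hb, sub_eq_add_neg]
      _ ≤ _ := by
        rw [← lintegral_const_mul' _ _ ENNReal.ofReal_ne_top]
        exact setLIntegral_Q_rpow_le hp0.le hεn hδ.le hv hM hA hAδ
  rw [habs]
  calc K p e / ENNReal.ofReal (κ * p) * ∫⁻ x, ‖∇ w x‖ₑ ^ p
      = ∫⁻ x, K p (∇ w x) / ENNReal.ofReal (κ * p) := by
        have hm : Measurable fun x => ‖∇ w x‖ₑ ^ p :=
          (continuous_gradient_mollify ρ hvl).measurable.enorm.pow_const _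
        rw [← lintegral_const_mul _ hm]
        refine lintegral_congr fun x => ?_
        rw [K_eq_norm_mul hN hp0 he (∇ w x), div_eq_mul_inv, div_eq_mul_inv]
        ring
    _ ≤ ∫⁻ x, liminf (fun n => ENNReal.ofReal (ε n / (p + ε n)) *
          ∫⁻ h in Metric.ball (0 : Euc N) r, W n h * ‖w (x + h) - w x‖ₑ ^ (p + ε n)) atTop :=
        lintegral_mono fun x =>
          K_gradient_le_liminf hN hp hκ hr hwd.continuous hwd.differentiableAt hε hε0
    _ ≤ liminf (fun n => ∫⁻ x, ENNReal.ofReal (ε n / (p + ε n)) *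
          ∫⁻ h in Metric.ball (0 : Euc N) r, W n h * ‖w (x + h) - w x‖ₑ ^ (p + ε n)) atTop := by
        refine lintegral_liminf_le fun n => Measurable.const_mul ?_ _
        refine Measurable.lintegral_prod_right' (f := fun z : Euc N × Euc N =>
          W n z.2 * ‖w (z.1 + z.2) - w z.1‖ₑ ^ (p + ε n)) ?_
        have h1 : Measurable fun z : Euc N × Euc N => w (z.1 + z.2) - w z.1 :=
          (hwm.comp (by fun_prop)).sub (hwm.comp measurable_fst)
        exact ((hWm n).comp measurable_snd).mul (h1.enorm.pow_const _)
    _ ≤ liminf (fun n => M * ENNReal.ofReal (δ ^ ε n)) atTop :=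
        liminf_le_liminf (Eventually.of_forall hbound)
    _ = M := by
        refine Tendsto.liminf_eq ?_
        have h1 : Tendsto (fun n => ENNReal.ofReal (δ ^ ε n)) atTop (𝓝 1) := by
          rw [← ENNReal.ofReal_one, ← Real.rpow_zero δ]
          exact ENNReal.tendsto_ofReal (tendsto_const_nhds.rpow hε0 (Or.inl hδ.ne'))
        simpa using ENNReal.Tendsto.const_mul h1 (Or.inl one_ne_zero) (a := M)

/-! ### Removing the boundedness assumption -/

lemma PhiLevel_mono {N : ℕ} {p γ t : ℝ} {u v : Euc N → ℝ}
    (h : ∀ x y, |v x - v y| ≤ |u x - u y|) : PhiLevel p γ t v ≤ PhiLevel p γ t u := by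
  unfold PhiLevel nu
  gcongr
  intro z (hz : t < |Q _ v z|)
  refine lt_of_lt_of_le hz ?_
  rw [Q, Q, abs_div, abs_div]
  exact div_le_div_of_nonneg_right (h _ _) (abs_nonneg _)

lemma PhiLevel_congr_ae {N : ℕ} {p γ t : ℝ} {u v : Euc N → ℝ} (h : u =ᵐ[volume] v) :
    PhiLevel p γ t u = PhiLevel p γ t v := by
  unfold PhiLevel nu
  congr 1
  refine setLIntegral_congr ?_
  filter_upwards [Measure.quasiMeasurePreserving_fst.ae h,
    Measure.quasiMeasurePreserving_snd.ae h] with z h1 h2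
  refine propext ?_
  change t < |Q _ u z| ↔ t < |Q _ v z|
  rw [Q, Q, h1, h2]

lemma abs_clamp_sub_clamp_le (k a b : ℝ) :
    |max (-k) (min k a) - max (-k) (min k b)| ≤ |a - b| := by
  refine (abs_max_sub_max_le_max _ _ _ _).trans ?_
  rw [sub_self, abs_zero, max_eq_right (abs_nonneg _)]
  refine (abs_min_sub_min_le_max _ _ _ _).trans ?_
  rw [sub_self, abs_zero, max_eq_right (abs_nonneg _)]

lemma abs_clamp_le {k : ℝ} (hk : 0 ≤ k) (a : ℝ) : |max (-k) (min k a)| ≤ k :=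
  abs_le.2 ⟨le_max_left _ _, max_le (by linarith) (min_le_left _ _)⟩

lemma tendsto_clamp (a : ℝ) :
    Tendsto (fun n : ℕ => max (-(n : ℝ)) (min (n : ℝ) a)) atTop (𝓝 a) := by
  refine tendsto_const_nhds.congr' ?_
  filter_upwards [eventually_ge_atTop ⌈|a|⌉₊] with n hn
  have h := abs_le.1 (Nat.ceil_le.1 hn)
  rw [min_eq_right h.2, max_eq_right h.1]

lemma tendsto_gradient_mollify {N : ℕ} (ρ : ContDiffBump (0 : Euc N)) {v : ℕ → Euc N → ℝ}
    {u : Euc N → ℝ} (hu : LocallyIntegrable u) (hv : ∀ n, AEStronglyMeasurable (v n) volume)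
    (hle : ∀ n x, |v n x| ≤ |u x|) (hlim : ∀ x, Tendsto (fun n => v n x) atTop (𝓝 (u x)))
    (x : Euc N) :
    Tendsto (fun n => ∇ (mollify ρ (v n)) x) atTop (𝓝 (∇ (mollify ρ u) x)) := by
  have hvl : ∀ n, LocallyIntegrable (v n) := fun n => hu.mono (hv n) (ae_of_all _ (hle n))
  set f := ρ.normed (volume : Measure (Euc N)) with hf
  have hcf : HasCompactSupport f := ρ.hasCompactSupport_normed
  have hf1 : ContDiff ℝ 1 f := ρ.contDiff_normed
  set B := (ContinuousLinearMap.lsmul ℝ ℝ : ℝ →L[ℝ] ℝ →L[ℝ] ℝ).precompL (Euc N) with hB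
  have hfd : Continuous (fderiv ℝ f) := hf1.continuous_fderiv (by simp)
  have hcfd : HasCompactSupport (fderiv ℝ f) := hcf.fderiv ℝ
  have hfderiv : ∀ g : Euc N → ℝ, LocallyIntegrable g →
      fderiv ℝ (mollify ρ g) x = ∫ t, B (fderiv ℝ f t) (g (x - t)) := fun g hg =>
    (hcf.hasFDerivAt_convolution_left (ContinuousLinearMap.lsmul ℝ ℝ) hf1 hg x).fderiv
  refine ((InnerProductSpace.toDual ℝ (Euc N)).symm.continuous.tendsto _).comp ?_
  simp_rw [hfderiv u hu, fun n => hfderiv (v n) (hvl n)]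
  have habs : LocallyIntegrable (fun y => |u y|) volume :=
    hu.mono hu.aestronglyMeasurable.norm (ae_of_all _ fun y => by simp)
  have hInt : Integrable fun t => ‖fderiv ℝ f t‖ * |u (x - t)| :=
    hcfd.norm.convolutionExists_left (ContinuousLinearMap.lsmul ℝ ℝ) hfd.norm habs x
  have hBapp : ∀ (A : Euc N →L[ℝ] ℝ) (b : ℝ), B A b = b • A := fun A b => by
    ext y; simp [hB, mul_comm]
  refine tendsto_integral_of_dominated_convergence
    (fun t => ‖fderiv ℝ f t‖ * |u (x - t)|) (fun n => ?_) hInt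
    (fun n => ae_of_all _ fun t => ?_) (ae_of_all _ fun t => ?_)
  · exact (hcfd.convolutionExists_left B hfd (hvl n) x).aestronglyMeasurable
  · rw [hBapp, norm_smul, mul_comm]
    gcongr
    exact hle n _
  · simp only [hBapp]
    exact (hlim (x - t)).smul_const _

lemma mollify_congr_ae {N : ℕ} (ρ : ContDiffBump (0 : Euc N)) {u v : Euc N → ℝ}
    (h : u =ᵐ[volume] v) : mollify ρ u = mollify ρ v :=
  convolution_congr _ (ae_eq_refl _) h

/-- The lower bound for the mollifications of a locally integrable function. Truncations of `u` have
smaller increments, hence smaller `Φ_t`, and the gradients of their mollifications converge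
pointwise. -/
theorem lintegral_gradient_mollify_le_limsup {N : ℕ} (hN : 1 ≤ N) {p γ : ℝ} (hp : 1 ≤ p)
    (hγ : γ < -p) {u : Euc N → ℝ} (hu : LocallyIntegrable u) (ρ : ContDiffBump (0 : Euc N))
    {e : Euc N} (he : ‖e‖ = 1) :
    K p e / ENNReal.ofReal |γ| * ∫⁻ x, ‖∇ (mollify ρ u) x‖ₑ ^ p ≤
      limsup (fun t : ℝ => PhiLevel p γ t u) (𝓝[>] 0) := by
  wlog hum : Measurable u generalizing u
  · obtain ⟨v, hvm, hv⟩ := hu.aestronglyMeasurable.aemeasurable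
    rw [mollify_congr_ae ρ hv]
    simp_rw [PhiLevel_congr_ae hv]
    exact this (hu.congr hv) hvm
  refine le_of_forall_gt_imp_ge_of_dense fun M hM => ?_
  obtain ⟨δ, hδ, hδM⟩ := mem_nhdsGT_iff_exists_Ioo_subset.1 (eventually_lt_of_limsup_lt hM)
  have hp0 : 0 < p := by linarith
  set v : ℕ → Euc N → ℝ := fun n x => max (-(n : ℝ)) (min (n : ℝ) (u x)) with hv
  have hvm : ∀ n, Measurable (v n) := fun n => by fun_prop
  have hvk : ∀ n x, |v n x| ≤ n := fun n x => abs_clamp_le n.cast_nonneg _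
  have hvu : ∀ n x, |v n x| ≤ |u x| := fun n x => by
    simpa using abs_clamp_sub_clamp_le n (u x) 0
  have hlim : ∀ x, Tendsto (fun n => ‖∇ (mollify ρ (v n)) x‖ₑ ^ p) atTop
      (𝓝 (‖∇ (mollify ρ u) x‖ₑ ^ p)) := fun x =>
    (tendsto_gradient_mollify ρ hu (fun n => (hvm n).aestronglyMeasurable) hvu
      (fun x => tendsto_clamp (u x)) x).enorm.ennrpow_const p
  have hmeas : ∀ n, Measurable fun x => ‖∇ (mollify ρ (v n)) x‖ₑ ^ p := fun n =>
    (continuous_gradient_mollify ρ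
      (locallyIntegrable_of_bounded (hvm n) (hvk n))).measurable.enorm.pow_const _
  have hc : K p e / ENNReal.ofReal |γ| ≠ ⊤ :=
    ENNReal.div_ne_top (K_ne_top hp0 he) (by simp; linarith)
  calc K p e / ENNReal.ofReal |γ| * ∫⁻ x, ‖∇ (mollify ρ u) x‖ₑ ^ p
      = ∫⁻ x, liminf (fun n => K p e / ENNReal.ofReal |γ| *
          ‖∇ (mollify ρ (v n)) x‖ₑ ^ p) atTop := by
        rw [← lintegral_const_mul' _ _ hc]
        refine lintegral_congr fun x => ?_
        exact (ENNReal.Tendsto.const_mul (hlim x) (Or.inr hc)).liminf_eq.symm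
    _ ≤ liminf (fun n => ∫⁻ x, K p e / ENNReal.ofReal |γ| *
          ‖∇ (mollify ρ (v n)) x‖ₑ ^ p) atTop :=
        lintegral_liminf_le fun n => (hmeas n).const_mul _
    _ ≤ liminf (fun _ : ℕ => M) atTop := by
        refine liminf_le_liminf (Eventually.of_forall fun n => ?_)
        rw [lintegral_const_mul' _ _ hc]
        refine lintegral_gradient_mollify_le_of_bounded hN hp hγ hδ (hvm n) (hvk n)
          (fun t ht => ?_) ρ he
        exact (PhiLevel_mono fun x y => abs_clamp_sub_clamp_le n (u x) (u y)).trans (hδM ht).le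
    _ = M := liminf_const M

end NonlocalBV

namespace NonlocalBV

/-! ### Weak compactness -/

/-- Bounded sequences in a Hilbert space converge weakly along every ultrafilter. -/
lemma exists_tendsto_inner {H : Type*} [NormedAddCommGroup H] [InnerProductSpace ℝ H]
    [CompleteSpace H] {ι : Type*} (U : Ultrafilter ι) {x : ι → H} {C : ℝ} (hC : ∀ n, ‖x n‖ ≤ C) :
    ∃ y : H, ∀ z, Tendsto (fun n => inner ℝ (x n) z) U (𝓝 (inner ℝ y z)) := by
  set ℓ : ι → WeakDual ℝ H := fun n =>
    StrongDual.toWeakDual (InnerProductSpace.toDual ℝ H (x n)) with hℓ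
  have hmem : ∀ n, ℓ n ∈ WeakDual.toStrongDual ⁻¹'
      Metric.closedBall (0 : StrongDual ℝ H) C := by
    intro n
    rw [mem_preimage, mem_closedBall_zero_iff]
    exact ((InnerProductSpace.toDual ℝ H).norm_map (x n)).le.trans (hC n)
  obtain ⟨L, -, hL⟩ := (WeakDual.isCompact_closedBall (0 : StrongDual ℝ H) C).ultrafilter_le_nhds
    (U.map ℓ) (by
      rw [le_principal_iff]
      exact mem_map.2 (univ_mem' hmem))
  refine ⟨(InnerProductSpace.toDual ℝ H).symm (WeakDual.toStrongDual L), fun z => ?_⟩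
  rw [InnerProductSpace.toDual_symm_apply]
  exact ((WeakDual.eval_continuous z).tendsto L).comp hL

/-- **Dunford–Pettis** on a finite measure space: if a sequence is, up to arbitrarily small errors in
`L¹`, uniformly bounded, then it has a weak limit in `L¹` along every ultrafilter. The bounded
approximations converge weakly in `L²`, and their limits form a Cauchy sequence in `L¹`. -/
theorem exists_tendsto_integral_mul {α ι : Type*} [MeasurableSpace α] {μ : Measure α}
    [IsFiniteMeasure μ] (U : Ultrafilter ι) {g : ι → α → ℝ} (hg : ∀ n, Integrable (g n) μ)
    {t : ℕ → ι → α → ℝ} (ht : ∀ m n, AEStronglyMeasurable (t m n) μ) {C : ℕ → ℝ}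
    (htC : ∀ m n x, |t m n x| ≤ C m) {η : ℕ → ℝ} (hη : Tendsto η atTop (𝓝 0))
    (hgt : ∀ m n, ∫ x, |g n x - t m n x| ∂μ ≤ η m) :
    ∃ G : α → ℝ, Integrable G μ ∧ ∀ (ψ : α → ℝ) (c : ℝ), Measurable ψ → (∀ x, |ψ x| ≤ c) →
      Tendsto (fun n => ∫ x, g n x * ψ x ∂μ) U (𝓝 (∫ x, G x * ψ x ∂μ)) := by
  have ht2 : ∀ m n, MemLp (t m n) 2 μ := fun m n =>
    MemLp.of_bound (ht m n) (C m) (ae_of_all _ (htC m n))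
  have hti : ∀ m n, Integrable (t m n) μ := fun m n => (ht2 m n).integrable (by norm_num)
  have hex : ∀ m, ∃ G : Lp ℝ 2 μ, ∀ z : Lp ℝ 2 μ,
      Tendsto (fun n => inner ℝ ((ht2 m n).toLp (t m n)) z) U (𝓝 (inner ℝ G z)) := by
    intro m
    refine exists_tendsto_inner U
      (C := (μ univ ^ ((2 : ℝ≥0∞).toReal)⁻¹ * ENNReal.ofReal (C m)).toReal) fun n => ?_
    rw [Lp.norm_toLp]
    refine ENNReal.toReal_mono (ENNReal.mul_ne_top (by finiteness) ENNReal.ofReal_ne_top) ?_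
    exact eLpNorm_le_of_ae_bound (ae_of_all _ (htC m n))
  choose G hG using hex
  have hGm : ∀ m, StronglyMeasurable (G m) := fun m => Lp.stronglyMeasurable _
  have hGi : ∀ m, Integrable (G m) μ := fun m => (Lp.memLp (G m)).integrable (by norm_num)
  have hmulψ : ∀ (f ψ : α → ℝ) (c : ℝ), Integrable f μ → Measurable ψ → (∀ x, |ψ x| ≤ c) →
      Integrable (fun x => f x * ψ x) μ := fun f ψ c hf hψ hc =>
    hf.mul_bdd hψ.aestronglyMeasurable (ae_of_all _ hc)
  have hle : ∀ (f ψ : α → ℝ) (c : ℝ), Integrable f μ → Measurable ψ → (∀ x, |ψ x| ≤ c) →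
      |∫ x, f x * ψ x ∂μ| ≤ c * ∫ x, |f x| ∂μ := by
    intro f ψ c hf hψ hc
    rw [← integral_const_mul]
    refine (abs_integral_le_integral_abs).trans
      (integral_mono (hmulψ f ψ c hf hψ hc).abs (hf.abs.const_mul c) fun x => ?_)
    simp only [abs_mul]
    rw [mul_comm]
    gcongr
    exact hc x
  have hweak : ∀ m (ψ : α → ℝ) (c : ℝ), Measurable ψ → (∀ x, |ψ x| ≤ c) →
      Tendsto (fun n => ∫ x, t m n x * ψ x ∂μ) U (𝓝 (∫ x, G m x * ψ x ∂μ)) := by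
    intro m ψ c hψ hc
    have hψ2 : MemLp ψ 2 μ := MemLp.of_bound hψ.aestronglyMeasurable c (ae_of_all _ hc)
    have h := hG m (hψ2.toLp ψ)
    simp only [L2.inner_def] at h
    have e1 : ∀ n, ∫ x, inner ℝ ((ht2 m n).toLp (t m n) x) (hψ2.toLp ψ x) ∂μ =
        ∫ x, t m n x * ψ x ∂μ := fun n => integral_congr_ae <| by
      filter_upwards [(ht2 m n).coeFn_toLp, hψ2.coeFn_toLp] with x h1 h2
      rw [h1, h2, Real.inner_apply]
    have e2 : ∫ x, inner ℝ (G m x) (hψ2.toLp ψ x) ∂μ = ∫ x, G m x * ψ x ∂μ :=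
      integral_congr_ae <| by
        filter_upwards [hψ2.coeFn_toLp] with x h2
        rw [h2, Real.inner_apply]
    rw [e2] at h
    exact h.congr e1
  have htt : ∀ m k n, ∫ x, |t m n x - t k n x| ∂μ ≤ η m + η k := by
    intro m k n
    calc ∫ x, |t m n x - t k n x| ∂μ ≤ ∫ x, (|g n x - t m n x| + |g n x - t k n x|) ∂μ := by
          refine integral_mono ((hti m n).sub (hti k n)).abs
            (((hg n).sub (hti m n)).abs.add ((hg n).sub (hti k n)).abs) fun x => ?_
          have := abs_sub_le (t m n x) (g n x) (t k n x)
          rw [abs_sub_comm (t m n x) (g n x)] at this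
          exact this
      _ = ∫ x, |g n x - t m n x| ∂μ + ∫ x, |g n x - t k n x| ∂μ :=
          integral_add ((hg n).sub (hti m n)).abs ((hg n).sub (hti k n)).abs
      _ ≤ _ := add_le_add (hgt m n) (hgt k n)
  -- testing with the sign of the difference of two limits gives their distance in `L¹`
  have hGG : ∀ m k, ∫ x, |G m x - G k x| ∂μ ≤ η m + η k := by
    intro m k
    set ψ : α → ℝ := fun x => if G m x - G k x < 0 then -1 else 1 with hψ_def
    have hψ : Measurable ψ := Measurable.ite
      (measurableSet_lt ((hGm m).measurable.sub (hGm k).measurable) measurable_const)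
      measurable_const measurable_const
    have hψ1 : ∀ x, |ψ x| ≤ 1 := fun x => by
      simp only [hψ_def]; split_ifs <;> simp
    have h := (hweak m ψ 1 hψ hψ1).sub (hweak k ψ 1 hψ hψ1)
    have e : ∫ x, |G m x - G k x| ∂μ = ∫ x, G m x * ψ x ∂μ - ∫ x, G k x * ψ x ∂μ := by
      rw [← integral_sub (hmulψ _ _ 1 (hGi m) hψ hψ1) (hmulψ _ _ 1 (hGi k) hψ hψ1)]
      refine integral_congr_ae (ae_of_all _ fun x => ?_)
      simp only [hψ_def]
      split_ifs with hx
      · rw [abs_of_neg hx]; ring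
      · rw [abs_of_nonneg (not_lt.1 hx)]; ring
    rw [e]
    refine le_of_tendsto h (Eventually.of_forall fun n => ?_)
    rw [← integral_sub (hmulψ _ _ 1 (hti m n) hψ hψ1) (hmulψ _ _ 1 (hti k n) hψ hψ1)]
    simp_rw [← sub_mul]
    refine (le_abs_self _).trans ((hle _ ψ 1 ((hti m n).sub (hti k n)) hψ hψ1).trans ?_)
    rw [one_mul]
    exact htt m k n
  have hcauchy : CauchySeq fun m => (hGi m).toL1 (G m) := by
    rw [Metric.cauchySeq_iff]
    intro ε hε
    obtain ⟨M, hM⟩ := eventually_atTop.1 (hη.eventually (gt_mem_nhds (half_pos hε)))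
    refine ⟨M, fun m hm k hk => ?_⟩
    rw [dist_eq_norm, ← Integrable.toL1_sub, L1.norm_of_fun_eq_integral_norm]
    have h1 := hGG m k
    have h2 := hM m hm
    have h3 := hM k hk
    simp only [Pi.sub_apply, Real.norm_eq_abs]
    linarith
  obtain ⟨F, hF⟩ := cauchySeq_tendsto_of_complete hcauchy
  have hFi : Integrable F μ := L1.integrable_coeFn F
  have hFlim : Tendsto (fun m => ∫ x, |G m x - F x| ∂μ) atTop (𝓝 0) := by
    rw [tendsto_iff_dist_tendsto_zero] at hF
    refine hF.congr fun m => ?_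
    have hF' : F = hFi.toL1 F := (Integrable.toL1_coeFn F hFi).symm
    conv_lhs => rw [hF']
    rw [dist_eq_norm, ← Integrable.toL1_sub, L1.norm_of_fun_eq_integral_norm]
    rfl
  refine ⟨F, hFi, fun ψ c hψ hc => ?_⟩
  rcases isEmpty_or_nonempty α with hα | ⟨⟨x₀⟩⟩
  · simp [integral_of_isEmpty]
  have hc0 : 0 ≤ c := (abs_nonneg _).trans (hc x₀)
  rw [Metric.tendsto_nhds]
  intro ε hε
  have hc1 : Tendsto (fun m => c * η m + c * ∫ x, |G m x - F x| ∂μ) atTop (𝓝 0) := by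
    simpa using (hη.const_mul c).add (hFlim.const_mul c)
  obtain ⟨m, hm⟩ := (hc1.eventually (gt_mem_nhds (half_pos hε))).exists
  filter_upwards [Metric.tendsto_nhds.1 (hweak m ψ c hψ hc) (ε / 2) (half_pos hε)] with n hn
  rw [Real.dist_eq] at hn ⊢
  have h1 : |∫ x, g n x * ψ x ∂μ - ∫ x, t m n x * ψ x ∂μ| ≤ c * η m := by
    rw [← integral_sub (hmulψ _ _ c (hg n) hψ hc) (hmulψ _ _ c (hti m n) hψ hc)]
    simp_rw [← sub_mul]
    refine (hle _ ψ c ((hg n).sub (hti m n)) hψ hc).trans ?_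
    exact mul_le_mul_of_nonneg_left (hgt m n) hc0
  have h2 : |∫ x, G m x * ψ x ∂μ - ∫ x, F x * ψ x ∂μ| ≤ c * ∫ x, |G m x - F x| ∂μ := by
    rw [← integral_sub (hmulψ _ _ c (hGi m) hψ hc) (hmulψ _ _ c hFi hψ hc)]
    simp_rw [← sub_mul]
    exact hle _ ψ c ((hGi m).sub hFi) hψ hc
  calc _ = |(∫ x, g n x * ψ x ∂μ - ∫ x, t m n x * ψ x ∂μ) +
        (∫ x, t m n x * ψ x ∂μ - ∫ x, G m x * ψ x ∂μ) +
        (∫ x, G m x * ψ x ∂μ - ∫ x, F x * ψ x ∂μ)| := by congr 1; ring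
    _ ≤ _ := abs_add_three _ _ _
    _ < ε := by linarith

/-- Sequences bounded in `L^p` of a finite measure, `p > 1`, have weak limits in `L¹`. They are
truncated at height `m + 1`; what is cut off is at most `(m + 1) ^ (1 - p) * |g n| ^ p`. -/
theorem exists_tendsto_integral_mul_of_lintegral_rpow_le {α ι : Type*} [MeasurableSpace α]
    {μ : Measure α} [IsFiniteMeasure μ] (U : Ultrafilter ι) {p : ℝ} (hp : 1 < p)
    {g : ι → α → ℝ} (hg : ∀ n, Measurable (g n)) {C : ℝ≥0∞} (hC : C ≠ ⊤)
    (hgC : ∀ n, ∫⁻ x, ‖g n x‖ₑ ^ p ∂μ ≤ C) :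
    ∃ G : α → ℝ, Integrable G μ ∧ ∀ (ψ : α → ℝ) (c : ℝ), Measurable ψ → (∀ x, |ψ x| ≤ c) →
      Tendsto (fun n => ∫ x, g n x * ψ x ∂μ) U (𝓝 (∫ x, G x * ψ x ∂μ)) := by
  have hp0 : 0 < p := by linarith
  have hInt : ∀ n, Integrable (g n) μ := by
    intro n
    have h : MemLp (g n) (ENNReal.ofReal p) μ := by
      refine ⟨(hg n).aestronglyMeasurable, ?_⟩
      rw [eLpNorm_lt_top_iff_lintegral_rpow_enorm_lt_top (by simpa using hp0)
        ENNReal.ofReal_ne_top, ENNReal.toReal_ofReal hp0.le]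
      exact (hgC n).trans_lt hC.lt_top
    exact h.integrable (by simpa using ENNReal.ofReal_le_ofReal hp.le)
  have hpow : ∀ n, ∫ x, |g n x| ^ p ∂μ ≤ C.toReal ∧ Integrable (fun x => |g n x| ^ p) μ := by
    intro n
    have h1 : ∫⁻ x, ENNReal.ofReal (|g n x| ^ p) ∂μ ≤ C := by
      simp_rw [ofReal_abs_rpow hp0.le]
      exact hgC n
    have hm : Measurable fun x => |g n x| ^ p := by
      have := hg n
      fun_prop
    constructor
    · rw [integral_eq_lintegral_of_nonneg_ae (ae_of_all _ fun x => by positivity)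
        hm.aestronglyMeasurable]
      exact ENNReal.toReal_mono hC h1
    · refine ⟨hm.aestronglyMeasurable, ?_⟩
      rw [hasFiniteIntegral_iff_ofReal (ae_of_all _ fun x => by positivity)]
      exact h1.trans_lt hC.lt_top
  set t : ℕ → ι → α → ℝ := fun m n x => if |g n x| ≤ m + 1 then g n x else 0 with ht
  have htm : ∀ m n, Measurable (t m n) := fun m n =>
    Measurable.ite (measurableSet_le (continuous_abs.measurable.comp (hg n)) measurable_const)
      (hg n) measurable_const
  have htb : ∀ (m : ℕ) n x, |t m n x| ≤ (m : ℝ) + 1 := by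
    intro m n x
    simp only [ht]
    split_ifs with h
    · exact h
    · rw [abs_zero]; positivity
  refine exists_tendsto_integral_mul U hInt (t := t) (C := fun m => (m : ℝ) + 1)
    (η := fun m => ((m : ℝ) + 1) ^ (-(p - 1)) * C.toReal)
    (fun m n => (htm m n).aestronglyMeasurable) htb ?_ fun m n => ?_
  · have h1 : Tendsto (fun m : ℕ => (m : ℝ) + 1) atTop atTop :=
      tendsto_atTop_add_const_right _ _ tendsto_natCast_atTop_atTop
    simpa using ((tendsto_rpow_neg_atTop (show 0 < p - 1 by linarith)).comp h1).mul_const C.toReal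
  · have hm0 : (0 : ℝ) < m + 1 := by positivity
    calc ∫ x, |g n x - t m n x| ∂μ ≤ ∫ x, ((m : ℝ) + 1) ^ (-(p - 1)) * |g n x| ^ p ∂μ := by
          refine integral_mono_of_nonneg (ae_of_all _ fun x => abs_nonneg _)
            ((hpow n).2.const_mul _) (ae_of_all _ fun x => ?_)
          simp only [ht]
          split_ifs with h
          · rw [sub_self, abs_zero]; positivity
          · have h' : (m : ℝ) + 1 < |g n x| := not_le.1 h
            have hg0 : 0 < |g n x| := hm0.trans h'
            rw [sub_zero, Real.rpow_neg hm0.le, ← div_eq_inv_mul, le_div_iff₀ (by positivity)]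
            calc |g n x| * ((m : ℝ) + 1) ^ (p - 1) ≤ |g n x| * |g n x| ^ (p - 1) := by
                  gcongr
              _ = |g n x| ^ p := by
                  rw [Real.rpow_sub_one hg0.ne']; field_simp
      _ ≤ _ := by
          rw [integral_const_mul]
          exact mul_le_mul_of_nonneg_left (hpow n).1 (by positivity)

end NonlocalBV

namespace NonlocalBV

open scoped Gradient

/-! ### Convergence of mollifications -/

/-- A sequence of bump functions shrinking to the origin. -/
noncomputable def shrinkingBump (N n : ℕ) : ContDiffBump (0 : Euc N) where
  rIn := 1 / ((n : ℝ) + 1) / 2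
  rOut := 1 / ((n : ℝ) + 1)
  rIn_pos := by positivity
  rIn_lt_rOut := half_lt_self (by positivity)

lemma tendsto_shrinkingBump_rOut (N : ℕ) :
    Tendsto (fun n => (shrinkingBump N n).rOut) atTop (𝓝 0) :=
  tendsto_one_div_nat_succ

lemma ae_tendsto_mollify {N : ℕ} {u : Euc N → ℝ} (hu : LocallyIntegrable u) :
    ∀ᵐ x, Tendsto (fun n => mollify (shrinkingBump N n) u x) atTop (𝓝 (u x)) := by
  refine ContDiffBump.ae_convolution_tendsto_right_of_locallyIntegrable (K := 2)
    (tendsto_shrinkingBump_rOut N) (Eventually.of_forall fun n => ?_) hu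
  simp only [shrinkingBump]
  linarith

open Convolution in
/-- Mollifications converge weakly. Writing the integral against `ψ` as the value at `0` of the
convolution with the reflection of `ψ`, which is continuous, reduces this to associativity of the
convolution. -/
lemma tendsto_integral_mollify_mul {N : ℕ} {u ψ : Euc N → ℝ} (hu : LocallyIntegrable u)
    (hψ : Continuous ψ) (hcψ : HasCompactSupport ψ) :
    Tendsto (fun n => ∫ x, mollify (shrinkingBump N n) u x * ψ x) atTop (𝓝 (∫ x, u x * ψ x)) := by
  set k : Euc N → ℝ := fun x => ψ (-x) with hk
  have hkc : Continuous k := hψ.comp continuous_neg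
  have hck : HasCompactSupport k := hcψ.comp_homeomorph (Homeomorph.neg _)
  set T := (ContinuousLinearMap.lsmul ℝ ℝ : ℝ →L[ℝ] ℝ →L[ℝ] ℝ) with hT
  have hF : Continuous (u ⋆[T, volume] k) := hck.continuous_convolution_right T hu hkc
  have habs : LocallyIntegrable (fun y => ‖u y‖) volume :=
    hu.mono hu.aestronglyMeasurable.norm (ae_of_all _ fun y => by simp)
  have hconv0 : ∀ f : Euc N → ℝ, (f ⋆[T, volume] k) 0 = ∫ x, f x * ψ x := fun f => by
    simp [convolution_def, hk, hT]
  have h := ContDiffBump.convolution_tendsto_right_of_continuous (μ := volume)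
    (tendsto_shrinkingBump_rOut N) hF (0 : Euc N)
  rw [hconv0 u] at h
  refine h.congr fun n => ?_
  rw [← hconv0]
  have hρc : Continuous ((shrinkingBump N n).normed volume) :=
    (shrinkingBump N n).continuous_normed
  have hρs : HasCompactSupport ((shrinkingBump N n).normed volume) :=
    (shrinkingBump N n).hasCompactSupport_normed
  refine (convolution_assoc T T T T (fun x y z => by simp [hT, mul_assoc])
    hρc.aestronglyMeasurable hu.aestronglyMeasurable hkc.aestronglyMeasurable
    (ae_of_all _ fun y => hρs.convolutionExists_left T hρc hu y)
    (ae_of_all _ fun x => hck.norm.convolutionExists_right _ habs hkc.norm x) ?_).symm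
  exact hρs.norm.convolutionExists_left _ hρc.norm
    (hck.norm.continuous_convolution_right _ habs hkc.norm).locallyIntegrable 0

/-! ### Integration by parts and the case of bounded variation -/

lemma gradient_apply_eq_partialDeriv {N : ℕ} (w : Euc N → ℝ) (x : Euc N) (i : Fin N) :
    (∇ w x) i = partialDeriv i w x := by
  have h : inner ℝ (∇ w x) (EuclideanSpace.single i (1 : ℝ)) =
      fderiv ℝ w x (EuclideanSpace.single i 1) := by
    rw [gradient, InnerProductSpace.toDual_symm_apply]
  rw [partialDeriv, ← h, EuclideanSpace.inner_single_right]
  simp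

lemma continuous_partialDeriv {N : ℕ} {f : Euc N → ℝ} (hf : ContDiff ℝ ∞ f) (i : Fin N) :
    Continuous (partialDeriv i f) :=
  (hf.continuous_fderiv (by simp)).clm_apply continuous_const

lemma hasCompactSupport_partialDeriv {N : ℕ} {f : Euc N → ℝ} (hf : HasCompactSupport f)
    (i : Fin N) : HasCompactSupport (partialDeriv i f) :=
  hf.fderiv_apply ℝ (EuclideanSpace.single i 1)

lemma integral_mul_partialDeriv {N : ℕ} {w φ : Euc N → ℝ} (hw : ContDiff ℝ ∞ w)
    (hφ : ContDiff ℝ ∞ φ) (hcφ : HasCompactSupport φ) (i : Fin N) :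
    ∫ x, w x * partialDeriv i φ x = -∫ x, (∇ w x) i * φ x := by
  simp_rw [gradient_apply_eq_partialDeriv]
  refine integral_mul_fderiv_eq_neg_fderiv_mul_of_integrable ?_ ?_ ?_
    (fun x _ => hw.differentiable (by simp) x) (fun x _ => hφ.differentiable (by simp) x)
  · exact ((continuous_partialDeriv hw i).mul hφ.continuous).integrable_of_hasCompactSupport
      hcφ.mul_left
  · exact (hw.continuous.mul (continuous_partialDeriv hφ i)).integrable_of_hasCompactSupport
      (hasCompactSupport_partialDeriv hcφ i).mul_left
  · exact (hw.continuous.mul hφ.continuous).integrable_of_hasCompactSupport hcφ.mul_left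

lemma contDiff_component {N : ℕ} {φ : Euc N → Euc N} (hφ : ContDiff ℝ ∞ φ) (i : Fin N) :
    ContDiff ℝ ∞ fun x => φ x i := by
  fun_prop

lemma hasCompactSupport_component {N : ℕ} {φ : Euc N → Euc N} (hφ : HasCompactSupport φ)
    (i : Fin N) : HasCompactSupport fun x => φ x i :=
  hφ.comp_left (g := fun y : Euc N => y i) (by simp)

lemma continuous_divergence {N : ℕ} {φ : Euc N → Euc N} (hφ : ContDiff ℝ ∞ φ) :
    Continuous (divergence φ) :=
  continuous_finsetSum _ fun i _ => continuous_partialDeriv (contDiff_component hφ i) i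

lemma hasCompactSupport_divergence {N : ℕ} {φ : Euc N → Euc N} (hφ : HasCompactSupport φ) :
    HasCompactSupport (divergence φ) := by
  refine HasCompactSupport.intro hφ fun x hx => ?_
  refine Finset.sum_eq_zero fun i _ => ?_
  refine image_eq_zero_of_notMem_tsupport fun h => hx ?_
  refine closure_mono (fun y hy => ?_) (tsupport_fderiv_apply_subset ℝ _ h)
  intro h0
  exact hy (by simp [h0])

lemma integral_mul_divergence {N : ℕ} {w : Euc N → ℝ} {φ : Euc N → Euc N} (hw : ContDiff ℝ ∞ w)
    (hφ : ContDiff ℝ ∞ φ) (hcφ : HasCompactSupport φ) :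
    ∫ x, w x * divergence φ x = -∫ x, inner ℝ (∇ w x) (φ x) := by
  have hg : Continuous (∇ w) :=
    (InnerProductSpace.toDual ℝ (Euc N)).symm.continuous.comp (hw.continuous_fderiv (by simp))
  have h1 : ∀ x, inner ℝ (∇ w x) (φ x) = ∑ i, (∇ w x) i * φ x i := fun x => by
    simp only [PiLp.inner_apply, Real.inner_apply]
  simp_rw [h1, divergence, Finset.mul_sum]
  rw [integral_finsetSum _ fun i _ => ?_, integral_finsetSum _ fun i _ => ?_,
    ← Finset.sum_neg_distrib]
  · exact Finset.sum_congr rfl fun i _ => integral_mul_partialDeriv hw (contDiff_component hφ i)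
      (hasCompactSupport_component hcφ i) i
  · exact Continuous.integrable_of_hasCompactSupport (by have := hφ.continuous; fun_prop)
      (hasCompactSupport_component hcφ i).mul_left
  · exact (hw.continuous.mul (continuous_partialDeriv (contDiff_component hφ i)
      i)).integrable_of_hasCompactSupport (hasCompactSupport_partialDeriv
        (hasCompactSupport_component hcφ i) i).mul_left

/-- The total variation is lower semicontinuous along mollifications. -/
theorem totalVariation_le_of_mollify {N : ℕ} {u : Euc N → ℝ} (hu : LocallyIntegrable u)
    {C : ℝ≥0∞} (hC : ∀ n, ∫⁻ x, ‖∇ (mollify (shrinkingBump N n) u) x‖ₑ ≤ C) :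
    totalVariation u ≤ C := by
  refine iSup_le fun φ => iSup_le fun hφ => iSup_le fun hcφ => iSup_le fun hφ1 => ?_
  have hlim := tendsto_integral_mollify_mul hu (continuous_divergence hφ)
    (hasCompactSupport_divergence hcφ)
  refine le_of_tendsto (ENNReal.tendsto_ofReal hlim.abs) (Eventually.of_forall fun n => ?_)
  rw [integral_mul_divergence (contDiff_mollify _ hu) hφ hcφ, abs_neg, ← Real.norm_eq_abs,
    ofReal_norm]
  refine (enorm_integral_le_lintegral_enorm _).trans (le_trans (lintegral_mono fun x => ?_) (hC n))
  rw [← ofReal_norm, ← ofReal_norm]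
  refine ENNReal.ofReal_le_ofReal ((norm_inner_le_norm _ _).trans ?_)
  exact mul_le_of_le_one_right (norm_nonneg _) (hφ1 x)

/-! ### Existence of the weak gradient for `p > 1` -/

/-- A sequence bounded in `L^p(ℝ^N)`, `p > 1`, has a weak limit against continuous functions with
compact support. A finite measure with positive continuous density replaces Lebesgue measure. -/
lemma exists_tendsto_integral_mul_euc {N : ℕ} (U : Ultrafilter ℕ) {p : ℝ} (hp : 1 < p)
    {g : ℕ → Euc N → ℝ} (hg : ∀ n, Measurable (g n)) {C : ℝ≥0∞} (hC : C ≠ ⊤)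
    (hgC : ∀ n, ∫⁻ x, ‖g n x‖ₑ ^ p ≤ C) :
    ∃ G : Euc N → ℝ, LocallyIntegrable G ∧ ∀ φ : Euc N → ℝ, Continuous φ → HasCompactSupport φ →
      Tendsto (fun n => ∫ x, g n x * φ x) U (𝓝 (∫ x, G x * φ x)) := by
  set d : Euc N → ℝ := fun x => (1 + ‖x‖) ^ (-((N : ℝ) + 1)) with hd
  have hd0 : ∀ x, 0 < d x := fun x => by positivity
  have hdc : Continuous d := (by fun_prop : Continuous fun x : Euc N => 1 + ‖x‖).rpow_const
    fun x => Or.inl (by positivity)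
  have hdi : Integrable d := integrable_one_add_norm (by simp)
  have hd1 : ∀ x, d x ≤ 1 := fun x =>
    Real.rpow_le_one_of_one_le_of_nonpos (by simp) (by linarith [N.cast_nonneg (α := ℝ)])
  have hdm : Measurable fun x => ENNReal.ofReal (d x) := hdc.measurable.ennreal_ofReal
  set μ : Measure (Euc N) := volume.withDensity fun x => ENNReal.ofReal (d x) with hμ
  have : IsFiniteMeasure μ := isFiniteMeasure_withDensity_ofReal hdi.2
  have hμle : μ ≤ volume := by
    conv_rhs => rw [← withDensity_one (μ := (volume : Measure (Euc N)))]
    exact withDensity_mono (ae_of_all _ fun x => ENNReal.ofReal_le_one.2 (hd1 x))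
  have hInt : ∀ f : Euc N → ℝ, ∀ φ : Euc N → ℝ,
      ∫ x, f x * (φ x / d x) ∂μ = ∫ x, f x * φ x := by
    intro f φ
    rw [hμ, integral_withDensity_eq_integral_toReal_smul hdm
      (ae_of_all _ fun x => ENNReal.ofReal_lt_top)]
    refine integral_congr_ae (ae_of_all _ fun x => ?_)
    have := (hd0 x).ne'
    simp only [ENNReal.toReal_ofReal (hd0 x).le, smul_eq_mul]
    field_simp
  obtain ⟨G, hG, hlim⟩ := exists_tendsto_integral_mul_of_lintegral_rpow_le (μ := μ) U hp hg hC
    fun n => (lintegral_mono' hμle le_rfl).trans (hgC n)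
  refine ⟨G, ?_, fun φ hφ hcφ => ?_⟩
  · rw [hμ, integrable_withDensity_iff_integrable_smul' hdm
      (ae_of_all _ fun x => ENNReal.ofReal_lt_top)] at hG
    refine (LocallyIntegrable.continuous_mul (hdc.inv₀ fun x => (hd0 x).ne')
      hG.locallyIntegrable).congr (ae_of_all _ fun x => ?_)
    have := (hd0 x).ne'
    simp only [ENNReal.toReal_ofReal (hd0 x).le, smul_eq_mul, Pi.inv_apply]
    field_simp
  · have hψ : Continuous fun x => φ x / d x := hφ.div hdc fun x => (hd0 x).ne'
    have hcψ : HasCompactSupport fun x => φ x / d x := by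
      simp_rw [div_eq_mul_inv]
      exact hcφ.mul_right
    obtain ⟨c, hc⟩ := hcψ.exists_bound_of_continuous hψ
    simpa only [hInt] using hlim _ c hψ.measurable hc

/-- The mollification of the weak gradient is the gradient of the mollification. -/
lemma gradient_mollify_apply {N : ℕ} (ρ : ContDiffBump (0 : Euc N)) {u G : Euc N → ℝ}
    (hu : LocallyIntegrable u) {i : Fin N}
    (hG : ∀ φ : Euc N → ℝ, ContDiff ℝ ∞ φ → HasCompactSupport φ →
      ∫ x, u x * partialDeriv i φ x = -∫ x, G x * φ x) (x : Euc N) :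
    (∇ (mollify ρ u) x) i = mollify ρ G x := by
  set f := ρ.normed (volume : Measure (Euc N)) with hf
  have hcf : HasCompactSupport f := ρ.hasCompactSupport_normed
  have hf1 : ContDiff ℝ ∞ f := ρ.contDiff_normed
  have hfd : Continuous (fderiv ℝ f) := hf1.continuous_fderiv (by simp)
  set B := (ContinuousLinearMap.lsmul ℝ ℝ : ℝ →L[ℝ] ℝ →L[ℝ] ℝ).precompL (Euc N) with hB
  have hfderiv : fderiv ℝ (mollify ρ u) x = ∫ t, B (fderiv ℝ f t) (u (x - t)) :=
    (hcf.hasFDerivAt_convolution_left (ContinuousLinearMap.lsmul ℝ ℝ) (hf1.of_le (by simp)) hu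
      x).fderiv
  have hBapp : ∀ (A : Euc N →L[ℝ] ℝ) (b : ℝ), B A b = b • A := fun A b => by
    ext y; simp [hB, mul_comm]
  have hInt : Integrable fun t => B (fderiv ℝ f t) (u (x - t)) :=
    (hcf.fderiv ℝ).convolutionExists_left B hfd hu x
  simp only [hBapp] at hInt hfderiv
  -- the weak gradient is tested with the reflected and translated bump function
  set φ : Euc N → ℝ := fun y => f (x - y) with hφ
  have hφd : ∀ y, partialDeriv i φ y = -partialDeriv i f (x - y) := by
    intro y
    have h1 : HasFDerivAt (fun y => x - y) (-(ContinuousLinearMap.id ℝ (Euc N))) y := by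
      simpa using (hasFDerivAt_id y).const_sub x
    have h2 := ((hf1.differentiable (by simp) (x - y)).hasFDerivAt.comp y h1).fderiv
    have h3 : fderiv ℝ φ y = (fderiv ℝ f (x - y)).comp (-(ContinuousLinearMap.id ℝ (Euc N))) := h2
    rw [partialDeriv, h3, partialDeriv]
    simp
  have hφs : ContDiff ℝ ∞ φ := hf1.comp (contDiff_const.sub contDiff_id)
  have hcφ : HasCompactSupport φ := hcf.comp_homeomorph (Homeomorph.subLeft x)
  calc (∇ (mollify ρ u) x) i = ∫ t, u (x - t) * partialDeriv i f t := by
        rw [gradient_apply_eq_partialDeriv, partialDeriv, hfderiv,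
          ContinuousLinearMap.integral_apply hInt]
        rfl
    _ = -∫ y, u y * partialDeriv i φ y := by
        rw [← integral_neg, ← integral_sub_left_eq_self _ volume x]
        refine integral_congr_ae (ae_of_all _ fun y => ?_)
        simp only [hφd]
        simp
    _ = ∫ y, G y * f (x - y) := by rw [hG φ hφs hcφ, neg_neg]
    _ = mollify ρ G x := by
        rw [mollify_apply, ← integral_sub_left_eq_self _ volume x]
        refine integral_congr_ae (ae_of_all _ fun y => ?_)
        simp only [sub_sub_cancel, mul_comm, hf]

/-- If the gradients of the mollifications of `u` are bounded in `L^p` with `p > 1`, then `u` has a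
weak gradient in `L^p`, with the same bound. -/
theorem exists_isWeakGradient_of_mollify {N : ℕ} {p : ℝ} (hp : 1 < p) {u : Euc N → ℝ}
    (hu : LocallyIntegrable u) {C : ℝ≥0∞} (hCtop : C ≠ ⊤)
    (hC : ∀ n, ∫⁻ x, ‖∇ (mollify (shrinkingBump N n) u) x‖ₑ ^ p ≤ C) :
    ∃ G : Euc N → Euc N, IsWeakGradient u G ∧ MemLp G (ENNReal.ofReal p) ∧
      ∫⁻ x, ‖G x‖ₑ ^ p ≤ C := by
  have hp0 : 0 < p := by linarith
  have hgc : ∀ n, Continuous (∇ (mollify (shrinkingBump N n) u)) := fun n =>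
    continuous_gradient_mollify _ hu
  have hex : ∀ i : Fin N, ∃ G : Euc N → ℝ, LocallyIntegrable G ∧
      ∀ φ : Euc N → ℝ, Continuous φ → HasCompactSupport φ →
        Tendsto (fun n => ∫ x, (∇ (mollify (shrinkingBump N n) u) x) i * φ x) (hyperfilter ℕ)
          (𝓝 (∫ x, G x * φ x)) := by
    intro i
    refine exists_tendsto_integral_mul_euc _ hp (fun n => ?_) hCtop fun n =>
      (lintegral_mono fun x => ?_).trans (hC n)
    · have := (hgc n).measurable
      fun_prop
    · gcongr
      rw [← ofReal_norm, ← ofReal_norm]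
      exact ENNReal.ofReal_le_ofReal (PiLp.norm_apply_le _ i)
  choose G hGl hG using hex
  have hweak : ∀ i, ∀ φ : Euc N → ℝ, ContDiff ℝ ∞ φ → HasCompactSupport φ →
      ∫ x, u x * partialDeriv i φ x = -∫ x, G i x * φ x := by
    intro i φ hφ hcφ
    have h1 := (tendsto_integral_mollify_mul hu (continuous_partialDeriv hφ i)
      (hasCompactSupport_partialDeriv hcφ i)).mono_left Nat.hyperfilter_le_atTop
    simp_rw [fun n => integral_mul_partialDeriv (contDiff_mollify (shrinkingBump N n) hu) hφ hcφ i]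
      at h1
    exact tendsto_nhds_unique h1 (hG i φ hφ.continuous hcφ).neg
  set H : Euc N → Euc N := fun x => WithLp.toLp 2 fun i => G i x with hH
  have hHm : AEStronglyMeasurable H volume := by
    have h1 : AEMeasurable (fun x i => G i x) volume :=
      aemeasurable_pi_lambda _ fun i => (hGl i).aestronglyMeasurable.aemeasurable
    exact ((WithLp.measurable_toLp 2 _).comp_aemeasurable h1).aestronglyMeasurable
  have hlim : ∀ᵐ x, Tendsto (fun n => ∇ (mollify (shrinkingBump N n) u) x) atTop (𝓝 (H x)) := by
    filter_upwards [ae_all_iff.2 fun i => ae_tendsto_mollify (hGl i)] with x hx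
    have h1 : Tendsto (fun n => fun i => mollify (shrinkingBump N n) (G i) x) atTop
        (𝓝 fun i => G i x) := tendsto_pi_nhds.2 hx
    refine (((PiLp.continuous_toLp 2 _).tendsto _).comp h1).congr fun n => ?_
    ext i
    exact (gradient_mollify_apply _ hu (hweak i) x).symm
  have hHC : ∫⁻ x, ‖H x‖ₑ ^ p ≤ C := by
    calc ∫⁻ x, ‖H x‖ₑ ^ p
        = ∫⁻ x, liminf (fun n => ‖∇ (mollify (shrinkingBump N n) u) x‖ₑ ^ p) atTop := by
          refine lintegral_congr_ae (hlim.mono fun x hx => ?_)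
          exact (hx.enorm.ennrpow_const p).liminf_eq.symm
      _ ≤ liminf (fun n => ∫⁻ x, ‖∇ (mollify (shrinkingBump N n) u) x‖ₑ ^ p) atTop :=
          lintegral_liminf_le fun n => (hgc n).measurable.enorm.pow_const _
      _ ≤ liminf (fun _ : ℕ => C) atTop := liminf_le_liminf (Eventually.of_forall hC)
      _ = C := liminf_const C
  have hHp : MemLp H (ENNReal.ofReal p) := by
    refine ⟨hHm, ?_⟩
    rw [eLpNorm_lt_top_iff_lintegral_rpow_enorm_lt_top (by simpa using hp0)
      ENNReal.ofReal_ne_top, ENNReal.toReal_ofReal hp0.le]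
    exact hHC.trans_lt hCtop.lt_top
  refine ⟨H, ⟨hu, hHp.locallyIntegrable ?_, fun φ hφ hcφ i => hweak i φ hφ hcφ⟩, hHp, hHC⟩
  simpa using ENNReal.ofReal_le_ofReal hp.le

end NonlocalBV

namespace NonlocalBV

open scoped Gradient

/-! ### The lower bound for `Φ` -/

/-- `Φ` is bounded by any common bound for the mollifications. -/
lemma Phi_le_of_mollify {N : ℕ} {p : ℝ} (hp : 1 ≤ p) {u : Euc N → ℝ} (hu : LocallyIntegrable u)
    {C : ℝ≥0∞} (hC : ∀ n, ∫⁻ x, ‖∇ (mollify (shrinkingBump N n) u) x‖ₑ ^ p ≤ C) :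
    Phi p u ≤ C := by
  unfold Phi
  split_ifs with h1
  · subst h1
    exact totalVariation_le_of_mollify hu (by simpa using hC)
  · rcases eq_or_ne C ⊤ with rfl | hCtop
    · exact le_top
    · obtain ⟨G, hG, hGp, hGC⟩ :=
        exists_isWeakGradient_of_mollify (lt_of_le_of_ne hp (Ne.symm h1)) hu hCtop hC
      refine (iInf_le_of_le G (iInf_le_of_le hG (iInf_le_of_le hGp ?_)))
      simpa only [ofReal_norm_rpow (zero_le_one.trans hp)] using hGC

end NonlocalBV

theorem mainTheorem2 (N : ℕ) (hN : 1 ≤ N) (p γ : ℝ) (hp : 1 ≤ p) (hγ : γ < -p)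
    (u : NonlocalBV.Euc N → ℝ) (hu : MemLp u (ENNReal.ofReal p)) :
    (∀ e : NonlocalBV.Euc N, ‖e‖ = 1 →
      NonlocalBV.K p e / ENNReal.ofReal |γ| * NonlocalBV.Phi p u ≤
        limsup (fun t : ℝ => NonlocalBV.PhiLevel p γ t u) (𝓝[>] 0)) ∧
    (limsup (fun t : ℝ => NonlocalBV.PhiLevel p γ t u) (𝓝[>] 0) < ⊤ →
      (1 < p → NonlocalBV.MemSobolev p u) ∧ (p = 1 → NonlocalBV.MemBV u)) := by
  have hp0 : 0 < p := by linarith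
  have hul : LocallyIntegrable u :=
    hu.locallyIntegrable (by simpa using ENNReal.ofReal_le_ofReal hp)
  set L := limsup (fun t : ℝ => NonlocalBV.PhiLevel p γ t u) (𝓝[>] 0) with hL
  have hc0 : ∀ e : NonlocalBV.Euc N, ‖e‖ = 1 → NonlocalBV.K p e / ENNReal.ofReal |γ| ≠ 0 :=
    fun e he => ENNReal.div_ne_zero.2 ⟨NonlocalBV.K_ne_zero hp0 he, ENNReal.ofReal_ne_top⟩
  have hctop : ∀ e : NonlocalBV.Euc N, ‖e‖ = 1 → NonlocalBV.K p e / ENNReal.ofReal |γ| ≠ ⊤ :=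
    fun e he => ENNReal.div_ne_top (NonlocalBV.K_ne_top hp0 he) (by simp; linarith)
  have hmoll : ∀ e : NonlocalBV.Euc N, ‖e‖ = 1 → ∀ n,
      ∫⁻ x, ‖gradient (NonlocalBV.mollify (NonlocalBV.shrinkingBump N n) u) x‖ₑ ^ p ≤
        L / (NonlocalBV.K p e / ENNReal.ofReal |γ|) := fun e he n => by
    rw [ENNReal.le_div_iff_mul_le (Or.inl (hc0 e he)) (Or.inl (hctop e he)), mul_comm]
    exact NonlocalBV.lintegral_gradient_mollify_le_limsup hN hp hγ hul _ he
  refine ⟨fun e he => ?_, fun hLtop => ?_⟩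
  · rw [mul_comm]
    exact ENNReal.mul_le_of_le_div (NonlocalBV.Phi_le_of_mollify hp hul (hmoll e he))
  · have he : ‖(EuclideanSpace.single ⟨0, hN⟩ 1 : NonlocalBV.Euc N)‖ = 1 := by simp
    have hC : L / (NonlocalBV.K p (EuclideanSpace.single ⟨0, hN⟩ 1 : NonlocalBV.Euc N) /
        ENNReal.ofReal |γ|) < ⊤ := ENNReal.div_lt_top hLtop.ne (hc0 _ he)
    refine ⟨fun hp1 => ?_, fun hp1 => ?_⟩
    · obtain ⟨G, hG, hGp, -⟩ :=
        NonlocalBV.exists_isWeakGradient_of_mollify hp1 hul hC.ne (hmoll _ he)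
      exact ⟨hu, G, hG, hGp⟩
    · subst hp1
      refine ⟨by simpa using hu, lt_of_le_of_lt ?_ hC⟩
      exact NonlocalBV.totalVariation_le_of_mollify hul (by simpa using hmoll _ he)
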